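/- For each $m\in\mathbb N$ let $n=n_m$ and $p=p_m$ be positive integers, and let $X_1,\dots,X_n$ (depending on $m$) be i.i.d. random vectors from $N_p(\mu,\Sigma)$, where $\Sigma=\Sigma_m$ is a diagonal matrix with positive diagonal entries and $\mu=\mu_m\in\mathbb R^p$. Let $\mu_0=\mu_{0,m}\in\mathbb R^p$ be given and assume that the null hypothesis $H_0:\mu=\mu_0$ holds. Put $\nu_1=n-1$, $$\bar X_j=\frac1n\sum_{i=1}^n X_{ij},\qquad s_j^2=\frac1{n-1}\sum_{i=1}^n (X_{ij}-\bar X_j)^2,\qquad t_{nj}=\frac{\sqrt n\,(\bar X_j-\mu_{0j})}{s_j},\qquad T_1=n\sum_{j=1}^p\log\Bigl(1+\frac{t_{nj}^2}{\nu_1}\Bigr).$$ Let $\Psi=\Gamma'/\Gamma$ be the digamma function on $(0,\infty)$, $D(x)=\Psi\bigl(\tfrac{x+1}2\bigr)-\Psi\bigl(\tfrac x2\bigr)$, $m_1=nD(\nu_1)$ and $m_2=n^2\{D(\nu_1)^2-2D'(\nu_1)\}$. Then: (a) If $n=n_m$ is the same fixed integer $n\ge 2$ for all $m$, then $$\frac{T_1-p\,m_1}{\sqrt{p\,(m_2-m_1^2)}}\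 \xrightarrow{\ \mathcal D\ }\ N(0,1)\qquad\text{as } p=p_m\to\infty .$$ (b) Let $k$ be a fixed positive integer with $k<\nu_1/2$ for all $m$. If $n=n_m\to\infty$ and $p=p_m\to\infty$ in such a way that $p=o(n^{2k})$, then $$\frac{T_1-p\,\xi_k}{\sqrt{2p}}\ \xrightarrow{\ \mathcal D\ }\ N(0,1),\qquad\text{where } \xi_k=n\sum_{i=1}^k\frac{(-1)^{i+1}a_i}{i},\quad a_i=\prod_{l=1}^i\frac{2l-1}{\nu_1-2l}.$$ -/

import Mathlib

open MeasureTheory ProbabilityTheory Filter Topology Asymptotics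

namespace DLRT

noncomputable section

/-- `X 0, …, X (n - 1)` are independent and identically distributed random vectors, each with the
`p`-variate normal distribution with mean vector `μ` and covariance matrix `S`. -/
def IsNormalSample {Ω : Type*} [MeasurableSpace Ω] (P : Measure Ω) {n p : ℕ}
    (X : Fin n → Ω → EuclideanSpace ℝ (Fin p)) (μ : EuclideanSpace ℝ (Fin p))
    (S : Matrix (Fin p) (Fin p) ℝ) : Prop :=
  iIndepFun X P ∧ ∀ i, HasLaw (X i) (multivariateGaussian μ S) P

/-- The number of degrees of freedom `ν₁ = n - 1`, as a real number. -/
def dof (n : ℕ) : ℝ := (n : ℝ) - 1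

/-- The `j`-th sample mean of the data `x`. -/
def sampleMean {n p : ℕ} (x : Fin n → EuclideanSpace ℝ (Fin p)) (j : Fin p) : ℝ :=
  (∑ i, x i j) / n

/-- The `j`-th sample variance of the data `x`. -/
def sampleVariance {n p : ℕ} (x : Fin n → EuclideanSpace ℝ (Fin p)) (j : Fin p) : ℝ :=
  (∑ i, (x i j - sampleMean x j) ^ 2) / dof n

/-- The one-sample `t`-statistic of the `j`-th coordinate, for the hypothesized mean `μ₀`. -/
def tStat {n p : ℕ} (μ₀ : EuclideanSpace ℝ (Fin p)) (x : Fin n → EuclideanSpace ℝ (Fin p))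
    (j : Fin p) : ℝ :=
  √(n : ℝ) * (sampleMean x j - μ₀ j) / √(sampleVariance x j)

/-- The diagonal likelihood ratio test statistic `T₁`, as a function of the data `x`. -/
def T₁ {n p : ℕ} (μ₀ : EuclideanSpace ℝ (Fin p)) (x : Fin n → EuclideanSpace ℝ (Fin p)) : ℝ :=
  n * ∑ j, Real.log (1 + tStat μ₀ x j ^ 2 / dof n)

/-- The digamma function `Ψ = Γ' / Γ`. -/
def digamma (x : ℝ) : ℝ := deriv Real.Gamma x / Real.Gamma x

/-- `D x = Ψ ((x + 1) / 2) - Ψ (x / 2)`. -/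
def D (x : ℝ) : ℝ := digamma ((x + 1) / 2) - digamma (x / 2)

/-- `m₁ = n D(ν₁)`. -/
def m₁ (n : ℕ) : ℝ := n * D (dof n)

/-- `m₂ = n² (D(ν₁)² - 2 D'(ν₁))`. -/
def m₂ (n : ℕ) : ℝ := (n : ℝ) ^ 2 * (D (dof n) ^ 2 - 2 * deriv D (dof n))

/-- `a_i = ∏_{l = 1}^{i} (2 l - 1) / (ν₁ - 2 l)`. -/
def a (n i : ℕ) : ℝ := ∏ l ∈ Finset.Icc 1 i, (2 * (l : ℝ) - 1) / (dof n - 2 * (l : ℝ))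

/-- `ξ_k = n ∑_{i = 1}^{k} (-1)^(i + 1) a_i / i`. -/
def ξ (n k : ℕ) : ℝ := n * ∑ i ∈ Finset.Icc 1 k, (-1 : ℝ) ^ (i + 1) * a n i / (i : ℝ)

end

end DLRT

/-!
Under the null hypothesis `1 + t_j² / ν` is `Q' / Q`, where `Q'` is the sum of squares of the `j`-th
column about the true mean and `Q` the one about the sample mean. Rotating the constant direction
onto a coordinate axis turns `t_j² / ν` into `A / Q` with independent chi-square variables `A` and
`Q` with `1` and `ν` degrees of freedom; its law is called `ratioLaw ν` below
(`map_meanRatio_pi_gaussianReal`). As the columns of the data are jointly Gaussian and uncorrelated,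
`T₁ / n` is a sum of `p` independent copies of `V = log (1 + A / Q)`, and the theorem is a central
limit theorem for arrays with independent, identically distributed entries in each row. Bounded
third moments suffice for it (`tendstoInDistribution_sum_div_sqrt_add`), by a Taylor expansion of
the characteristic function.

It remains to find the moments of `V`. Absorbing powers of `Q` into its gamma density gives the
moment generating function of `V` as a quotient of Gamma functions, so that the derivative of its
cumulant generating function is `t ↦ D (ν - 2 t)` near `0`. Hence `V` has mean `D ν` and variance
`-2 D' ν`, which is part (a). For part (b), the moments of `A / Q` are the numbers `a_i`, and the
expansion of the logarithm with remainder at most `x ^ (k + 1) / (k + 1)` shows that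
`n D ν - ξ_k = O(n ^ (-k))`, which is negligible against `p ^ (-1/2)`; the same expansion yields
that `n V` has variance tending to `2`, and `V ≤ A / Q` bounds its third moments.
-/

namespace DLRT

open scoped ENNReal

/-! ### Gamma and chi-square laws -/

/-- Weighting a gamma law by `x ^ s * exp (t x)` gives a multiple of the gamma law with shape
`a + s` and rate `r - t`. -/
lemma lintegral_rpow_mul_exp_gammaMeasure {a r s t : ℝ} (ha : 0 < a) (hr : 0 < r)
    (has : 0 < a + s) (ht : t < r) {f : ℝ → ℝ≥0∞} (hf : Measurable f) :
    ∫⁻ x, ENNReal.ofReal (x ^ s * Real.exp (t * x)) * f x ∂gammaMeasure a r =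
      ENNReal.ofReal (r ^ a / Real.Gamma a * (Real.Gamma (a + s) / (r - t) ^ (a + s))) *
        ∫⁻ x, f x ∂gammaMeasure (a + s) (r - t) := by
  have hm (b c : ℝ) : Measurable (gammaPDF b c) := (measurable_gammaPDFReal b c).ennreal_ofReal
  have hrt : 0 < r - t := sub_pos.2 ht
  rw [gammaMeasure, gammaMeasure, lintegral_withDensity_eq_lintegral_mul _ (hm _ _) (by fun_prop),
    lintegral_withDensity_eq_lintegral_mul _ (hm _ _) hf, ← lintegral_const_mul _ (by fun_prop)]
  refine lintegral_congr_ae ?_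
  filter_upwards [Measure.ae_ne volume (0 : ℝ)] with x hx
  simp only [Pi.mul_apply]
  rcases lt_or_gt_of_ne hx with h | h
  · simp [gammaPDF_of_neg h]
  · rw [gammaPDF_of_nonneg h.le, gammaPDF_of_nonneg h.le, ← mul_assoc, ← mul_assoc,
      ← ENNReal.ofReal_mul (by positivity), ← ENNReal.ofReal_mul (by positivity)]
    congr 2
    have h1 : x ^ (a + s - 1) = x ^ (a - 1) * x ^ s := by
      rw [← Real.rpow_add h]; ring_nf
    have h2 : Real.exp (-((r - t) * x)) = Real.exp (-(r * x)) * Real.exp (t * x) := by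
      rw [← Real.exp_add]; ring_nf
    have h3 := (Real.Gamma_pos_of_pos has).ne'
    have h4 := (Real.rpow_pos_of_pos hrt (a + s)).ne'
    rw [h1, h2]
    field_simp

lemma ae_pos_gammaMeasure (a r : ℝ) : ∀ᵐ x ∂gammaMeasure a r, 0 < x := by
  have hm : Measurable (gammaPDF a r) := (measurable_gammaPDFReal a r).ennreal_ofReal
  rw [gammaMeasure, ae_withDensity_iff hm]
  filter_upwards [Measure.ae_ne volume (0 : ℝ)] with x hx h
  rcases lt_or_gt_of_ne hx with h' | h'
  · exact absurd (gammaPDF_of_neg h') h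
  · exact h'

lemma lintegral_rpow_gammaMeasure {a r s : ℝ} (ha : 0 < a) (hr : 0 < r) (has : 0 < a + s) :
    ∫⁻ x, ENNReal.ofReal (x ^ s) ∂gammaMeasure a r =
      ENNReal.ofReal (Real.Gamma (a + s) / Real.Gamma a / r ^ s) := by
  have := isProbabilityMeasure_gammaMeasure has hr
  have h := lintegral_rpow_mul_exp_gammaMeasure (t := 0) ha hr has hr
    (measurable_const (a := (1 : ℝ≥0∞)))
  simp only [zero_mul, Real.exp_zero, mul_one, sub_zero, lintegral_const, measure_univ] at h
  rw [h, Real.rpow_add hr]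
  congr 1
  have := (Real.rpow_pos_of_pos hr a).ne'
  field_simp

lemma integrable_exp_and_mgf_gammaMeasure {a r t : ℝ} (ha : 0 < a) (hr : 0 < r) (ht : t < r) :
    Integrable (fun x => Real.exp (t * x)) (gammaMeasure a r) ∧
      mgf id (gammaMeasure a r) t = (r / (r - t)) ^ a := by
  have hrt : 0 < r - t := sub_pos.2 ht
  have := isProbabilityMeasure_gammaMeasure ha hrt
  have h := lintegral_rpow_mul_exp_gammaMeasure (s := 0) (t := t) ha hr (by simpa using ha) ht
    (measurable_const (a := (1 : ℝ≥0∞)))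
  simp only [Real.rpow_zero, one_mul, mul_one, add_zero, lintegral_const, measure_univ] at h
  have hc : r ^ a / Real.Gamma a * (Real.Gamma a / (r - t) ^ a) = (r / (r - t)) ^ a := by
    rw [Real.div_rpow hr.le hrt.le]
    have := (Real.Gamma_pos_of_pos ha).ne'
    field_simp
  rw [hc] at h
  constructor
  · refine ⟨by fun_prop, ?_⟩
    rw [hasFiniteIntegral_iff_ofReal (ae_of_all _ fun x => (Real.exp_pos _).le), h]
    exact ENNReal.ofReal_lt_top
  · rw [mgf, integral_eq_lintegral_of_nonneg_ae (ae_of_all _ fun x => (Real.exp_pos _).le)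
      (by fun_prop)]
    simp only [id]
    rw [h, ENNReal.toReal_ofReal (by positivity)]

lemma ball_subset_interior_integrableExpSet {Ω : Type*} [MeasurableSpace Ω] {P : Measure Ω}
    {X : Ω → ℝ} {ε : ℝ} (hX : ∀ t, |t| < ε → Integrable (fun ω => Real.exp (t * X ω)) P) :
    Metric.ball 0 ε ⊆ interior (integrableExpSet X P) :=
  interior_maximal (fun t ht => hX t (by simpa using ht)) Metric.isOpen_ball

/-- Moment generating functions that agree near `0` determine the law. -/
lemma map_eq_of_mgf_eqOn {Ω Ω' : Type*} [MeasurableSpace Ω] [MeasurableSpace Ω']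
    {P : Measure Ω} {P' : Measure Ω'} [IsProbabilityMeasure P] [IsProbabilityMeasure P']
    {X : Ω → ℝ} {Y : Ω' → ℝ} (hX : AEMeasurable X P) (hY : AEMeasurable Y P') {ε : ℝ} (hε : 0 < ε)
    (hXi : ∀ t, |t| < ε → Integrable (fun ω => Real.exp (t * X ω)) P)
    (hYi : ∀ t, |t| < ε → Integrable (fun ω => Real.exp (t * Y ω)) P')
    (h : ∀ t, |t| < ε → mgf X P t = mgf Y P' t) : P.map X = P'.map Y := by
  have hconv : IsPreconnected {z : ℂ | z.re ∈ Metric.ball (0 : ℝ) ε} :=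
    ((convex_ball (0 : ℝ) ε).linear_preimage Complex.reLm).isPreconnected
  have key : Set.EqOn (complexMGF X P) (complexMGF Y P') {z | z.re ∈ Metric.ball (0 : ℝ) ε} := by
    refine AnalyticOnNhd.eqOn_of_preconnected_of_frequently_eq
      (analyticOnNhd_complexMGF.mono fun z hz => ball_subset_interior_integrableExpSet hXi hz)
      (analyticOnNhd_complexMGF.mono fun z hz => ball_subset_interior_integrableExpSet hYi hz)
      hconv (z₀ := 0) (by simpa using hε) ?_
    -- The two functions agree at these real points, which accumulate at `0`.
    have hlim : Tendsto (fun n : ℕ => ((ε / (n + 2) : ℝ) : ℂ)) atTop (𝓝[≠] 0) := by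
      refine tendsto_nhdsWithin_iff.2 ⟨?_, Eventually.of_forall fun n => ?_⟩
      · rw [← Complex.ofReal_zero]
        refine (Complex.continuous_ofReal.tendsto 0).comp ?_
        exact tendsto_const_nhds.div_atTop
          (tendsto_atTop_add_const_right _ _ tendsto_natCast_atTop_atTop)
      · have : (0 : ℝ) < ε / (n + 2) := by positivity
        exact Complex.ofReal_ne_zero.2 this.ne'
    refine hlim.frequently (Frequently.of_forall fun n => ?_)
    rw [complexMGF_ofReal, complexMGF_ofReal, h]
    have h0 : (0 : ℝ) < n + 2 := by positivity
    rw [abs_of_pos (by positivity), div_lt_iff₀ h0]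
    nlinarith [(Nat.cast_nonneg n : (0 : ℝ) ≤ n)]
  have := Measure.isProbabilityMeasure_map hX
  have := Measure.isProbabilityMeasure_map hY
  refine Measure.ext_of_charFun (funext fun t => ?_)
  rw [← complexMGF_mul_I hX, ← complexMGF_mul_I hY]
  exact key (by simpa using hε)

/-- The sum of independent gamma variables with a common rate is a gamma variable. -/
lemma map_add_gammaMeasure {a b r : ℝ} (ha : 0 < a) (hb : 0 < b) (hr : 0 < r) :
    ((gammaMeasure a r).prod (gammaMeasure b r)).map (fun x => x.1 + x.2) =
      gammaMeasure (a + b) r := by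
  have := isProbabilityMeasure_gammaMeasure ha hr
  have := isProbabilityMeasure_gammaMeasure hb hr
  have := isProbabilityMeasure_gammaMeasure (add_pos ha hb) hr
  have hind : IndepFun (fun x : ℝ × ℝ => x.1) (fun x : ℝ × ℝ => x.2)
      ((gammaMeasure a r).prod (gammaMeasure b r)) :=
    indepFun_prod (X := id) (Y := id) measurable_id measurable_id
  have hlt {t : ℝ} (ht : |t| < r) : t < r := (abs_lt.1 ht).2
  have hi1 {t : ℝ} (ht : t < r) : Integrable (fun x : ℝ × ℝ => Real.exp (t * x.1))
      ((gammaMeasure a r).prod (gammaMeasure b r)) :=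
    (integrable_exp_and_mgf_gammaMeasure ha hr ht).1.comp_fst _
  have hi2 {t : ℝ} (ht : t < r) : Integrable (fun x : ℝ × ℝ => Real.exp (t * x.2))
      ((gammaMeasure a r).prod (gammaMeasure b r)) :=
    (integrable_exp_and_mgf_gammaMeasure hb hr ht).1.comp_snd _
  have hm1 (t : ℝ) : mgf (fun x : ℝ × ℝ => x.1) ((gammaMeasure a r).prod (gammaMeasure b r)) t =
      mgf id (gammaMeasure a r) t := by
    simpa [mgf] using integral_fun_fst (μ := gammaMeasure a r) (ν := gammaMeasure b r)
      (fun x => Real.exp (t * x))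
  have hm2 (t : ℝ) : mgf (fun x : ℝ × ℝ => x.2) ((gammaMeasure a r).prod (gammaMeasure b r)) t =
      mgf id (gammaMeasure b r) t := by
    simpa [mgf] using integral_fun_snd (μ := gammaMeasure a r) (ν := gammaMeasure b r)
      (fun x => Real.exp (t * x))
  have := map_eq_of_mgf_eqOn (X := fun x : ℝ × ℝ => x.1 + x.2) (Y := (id : ℝ → ℝ))
    (P := (gammaMeasure a r).prod (gammaMeasure b r)) (P' := gammaMeasure (a + b) r)
    (by fun_prop) aemeasurable_id hr
    (fun t ht => by
      exact hind.integrable_exp_mul_add (hi1 (hlt ht)) (hi2 (hlt ht)))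
    (fun t ht => (integrable_exp_and_mgf_gammaMeasure (add_pos ha hb) hr (hlt ht)).1)
    (fun t ht => by
      have h0 : 0 < r / (r - t) := div_pos hr (sub_pos.2 (hlt ht))
      rw [(integrable_exp_and_mgf_gammaMeasure (add_pos ha hb) hr (hlt ht)).2, Real.rpow_add h0,
        ← (integrable_exp_and_mgf_gammaMeasure ha hr (hlt ht)).2,
        ← (integrable_exp_and_mgf_gammaMeasure hb hr (hlt ht)).2, ← hm1, ← hm2]
      exact hind.mgf_add (by fun_prop) (by fun_prop))
  simpa using this

lemma integrable_exp_and_mgf_sq_gaussianReal {t : ℝ} (ht : t < 1 / 2) :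
    Integrable (fun x => Real.exp (t * x ^ 2)) (gaussianReal 0 1) ∧
      mgf (fun x => x ^ 2) (gaussianReal 0 1) t = (1 / 2 / (1 / 2 - t)) ^ (1 / 2 : ℝ) := by
  have hb : 0 < 1 / 2 - t := sub_pos.2 ht
  have hpt (x : ℝ) : gaussianPDFReal 0 1 x * Real.exp (t * x ^ 2) =
      (√(2 * Real.pi))⁻¹ * Real.exp (-(1 / 2 - t) * x ^ 2) := by
    simp only [gaussianPDFReal, NNReal.coe_one, mul_one, sub_zero, mul_assoc, ← Real.exp_add]
    ring_nf
  constructor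
  · rw [gaussianReal_of_var_ne_zero _ one_ne_zero, gaussianPDF_def,
      integrable_withDensity_iff (by fun_prop) (by simp)]
    have : (fun x => Real.exp (t * x ^ 2) * (ENNReal.ofReal (gaussianPDFReal 0 1 x)).toReal) =
        fun x => (√(2 * Real.pi))⁻¹ * Real.exp (-(1 / 2 - t) * x ^ 2) := by
      ext x
      rw [ENNReal.toReal_ofReal (gaussianPDFReal_nonneg _ _ _), mul_comm, hpt]
    rw [this]
    exact (integrable_exp_neg_mul_sq hb).const_mul _
  · rw [mgf, integral_gaussianReal_eq_integral_smul one_ne_zero]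
    simp_rw [smul_eq_mul, hpt]
    rw [integral_const_mul, integral_gaussian, ← Real.sqrt_inv, ← Real.sqrt_mul (by positivity),
      ← Real.sqrt_eq_rpow]
    congr 1
    have := Real.pi_pos.ne'
    field_simp

/-- The chi-square law with `d` degrees of freedom is the gamma law with shape `d / 2` and rate
`1 / 2`. -/
lemma map_sum_sq_pi_gaussianReal {d : ℕ} (hd : 0 < d) :
    (Measure.pi fun _ : Fin d => gaussianReal 0 1).map (fun x => ∑ i, x i ^ 2) =
      gammaMeasure (d / 2) (1 / 2) := by
  have hd2 : (0 : ℝ) < d / 2 := by positivity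
  have hh : (0 : ℝ) < 1 / 2 := by norm_num
  have := isProbabilityMeasure_gammaMeasure hd2 hh
  have hlt {t : ℝ} (ht : |t| < 1 / 2) : t < 1 / 2 := (abs_lt.1 ht).2
  have hind : iIndepFun (fun (i : Fin d) (x : Fin d → ℝ) => x i ^ 2)
      (Measure.pi fun _ : Fin d => gaussianReal 0 1) :=
    iIndepFun_pi (X := fun _ x => x ^ 2) (by fun_prop)
  have hi {t : ℝ} (ht : t < 1 / 2) (i : Fin d) :
      Integrable (fun x : Fin d → ℝ => Real.exp (t * x i ^ 2))
        (Measure.pi fun _ : Fin d => gaussianReal 0 1) :=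
    integrable_comp_eval (μ := fun _ : Fin d => gaussianReal 0 1) (i := i)
      (f := fun x : ℝ => Real.exp (t * x ^ 2))
      (integrable_exp_and_mgf_sq_gaussianReal ht).1
  have hsum : (fun x : Fin d → ℝ => ∑ i, x i ^ 2) =
      ∑ i, (fun x : Fin d → ℝ => x i ^ 2) := by
    ext x; simp
  have := map_eq_of_mgf_eqOn (X := ∑ i, fun x : Fin d → ℝ => x i ^ 2) (Y := (id : ℝ → ℝ))
    (P := Measure.pi fun _ : Fin d => gaussianReal 0 1) (P' := gammaMeasure (d / 2) (1 / 2))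
    (by rw [← hsum]; exact Measurable.aemeasurable (by fun_prop)) aemeasurable_id hh
    (fun t ht => by
      exact hind.integrable_exp_mul_sum (by fun_prop) (fun i _ => hi (hlt ht) i))
    (fun t ht => (integrable_exp_and_mgf_gammaMeasure hd2 hh (hlt ht)).1)
    (fun t ht => by
      have h0 : 0 < 1 / 2 / (1 / 2 - t) := div_pos hh (sub_pos.2 (hlt ht))
      have hm (i : Fin d) : mgf (fun x : Fin d → ℝ => x i ^ 2)
          (Measure.pi fun _ : Fin d => gaussianReal 0 1) t =
            (1 / 2 / (1 / 2 - t)) ^ (1 / 2 : ℝ) := by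
        rw [← (integrable_exp_and_mgf_sq_gaussianReal (hlt ht)).2]
        exact integral_comp_eval (μ := fun _ : Fin d => gaussianReal 0 1) (i := i)
          (f := fun x : ℝ => Real.exp (t * x ^ 2)) (by fun_prop)
      rw [(integrable_exp_and_mgf_gammaMeasure hd2 hh (hlt ht)).2,
        hind.mgf_sum (by fun_prop)]
      simp_rw [hm]
      rw [Finset.prod_const, Finset.card_univ, Fintype.card_fin, ← Real.rpow_natCast,
        ← Real.rpow_mul h0.le]
      congr 1
      ring)
  simpa [← hsum] using this

/-! ### The law of the squared Student statistic and of its logarithm -/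

/-- The law of `t² / ν`, for a Student `t` variable with `ν` degrees of freedom: the law of `A / Q`
for independent chi-square variables `A` and `Q` with `1` and `ν` degrees of freedom. -/
noncomputable def ratioLaw (ν : ℕ) : Measure ℝ :=
  ((gammaMeasure (1 / 2) (1 / 2)).prod (gammaMeasure (ν / 2) (1 / 2))).map (fun x => x.1 / x.2)

lemma isProbabilityMeasure_gammaMeasure_half {b : ℝ} (hb : 0 < b) :
    IsProbabilityMeasure (gammaMeasure b (1 / 2)) :=
  isProbabilityMeasure_gammaMeasure hb (by norm_num)

lemma isProbabilityMeasure_ratioLaw {ν : ℕ} (hν : 0 < ν) : IsProbabilityMeasure (ratioLaw ν) := by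
  have := isProbabilityMeasure_gammaMeasure_half (b := 1 / 2) (by norm_num)
  have := isProbabilityMeasure_gammaMeasure_half (b := ν / 2) (by positivity)
  exact Measure.isProbabilityMeasure_map (Measurable.aemeasurable (by fun_prop))

lemma ae_pos_gammaMeasure_prod {ν : ℕ} (hν : 0 < ν) :
    ∀ᵐ x ∂(gammaMeasure (1 / 2) (1 / 2)).prod (gammaMeasure (ν / 2) (1 / 2)),
      0 < x.1 ∧ 0 < x.2 := by
  have := isProbabilityMeasure_gammaMeasure_half (b := 1 / 2) (by norm_num)
  have := isProbabilityMeasure_gammaMeasure_half (b := ν / 2) (by positivity)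
  exact (Measure.quasiMeasurePreserving_fst.ae (ae_pos_gammaMeasure _ _)).and
    (Measure.quasiMeasurePreserving_snd.ae (ae_pos_gammaMeasure _ _))

lemma ae_pos_ratioLaw {ν : ℕ} (hν : 0 < ν) : ∀ᵐ r ∂ratioLaw ν, 0 < r := by
  rw [ratioLaw, ae_map_iff (Measurable.aemeasurable (by fun_prop)) measurableSet_Ioi]
  filter_upwards [ae_pos_gammaMeasure_prod hν] with x hx using div_pos hx.1 hx.2

lemma dof_succ (ν : ℕ) : dof (ν + 1) = ν := by simp [dof]

lemma a_succ (ν i : ℕ) : a (ν + 1) (i + 1) =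
    a (ν + 1) i * ((2 * ((i : ℝ) + 1) - 1) / (ν - 2 * ((i : ℝ) + 1))) := by
  rw [a, a, Finset.prod_Icc_succ_top (by lia), dof_succ]
  push_cast
  rfl

/-- The Gamma factors in the `i`-th moment of `ratioLaw ν` telescope to `a_i`. -/
lemma gamma_ratio_eq_a {ν i : ℕ} (hi : (i : ℝ) < ν / 2) :
    Real.Gamma (1 / 2 + i) / Real.Gamma (1 / 2) *
      (Real.Gamma (ν / 2 - i) / Real.Gamma (ν / 2)) = a (ν + 1) i := by
  induction i with
  | zero =>
    have h1 := (Real.Gamma_pos_of_pos (show (0 : ℝ) < 1 / 2 by norm_num)).ne'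
    have h2 := (Real.Gamma_pos_of_pos (show (0 : ℝ) < ν / 2 by simpa using hi)).ne'
    simp only [Nat.cast_zero, add_zero, sub_zero, div_self h1, div_self h2, mul_one]
    simp [a]
  | succ i ih =>
    push_cast at hi ⊢
    rw [a_succ, ← ih (by linarith)]
    have h1 : Real.Gamma (1 / 2 + (i + 1)) = (1 / 2 + i) * Real.Gamma (1 / 2 + i) := by
      rw [← Real.Gamma_add_one (by positivity)]; ring_nf
    have h2 : Real.Gamma (ν / 2 - i) = (ν / 2 - (i + 1)) * Real.Gamma (ν / 2 - (i + 1)) := by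
      rw [← Real.Gamma_add_one (by linarith)]; ring_nf
    rw [h1, h2]
    have h3 : (ν / 2 - (i + 1) : ℝ) ≠ 0 := by linarith
    have h4 : (ν - 2 * (i + 1) : ℝ) ≠ 0 := by linarith
    have h5 : (ν / 2 - (i + 1) : ℝ) = (ν - 2 * (i + 1)) / 2 := by ring
    rw [h5]
    field_simp
    ring

lemma lintegral_pow_ratioLaw {ν i : ℕ} (hν : 0 < ν) (hi : (i : ℝ) < ν / 2) :
    ∫⁻ r, ENNReal.ofReal (r ^ i) ∂ratioLaw ν = ENNReal.ofReal (a (ν + 1) i) := by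
  have := isProbabilityMeasure_gammaMeasure_half (b := 1 / 2) (by norm_num)
  have := isProbabilityMeasure_gammaMeasure_half (b := ν / 2) (by positivity)
  have h0 : (0 : ℝ) < 1 / 2 + i := by positivity
  rw [ratioLaw, lintegral_map (by fun_prop) (by fun_prop)]
  have : ∀ᵐ x ∂(gammaMeasure (1 / 2) (1 / 2)).prod (gammaMeasure (ν / 2) (1 / 2)),
      ENNReal.ofReal ((x.1 / x.2) ^ i) =
        ENNReal.ofReal (x.1 ^ (i : ℝ)) * ENNReal.ofReal (x.2 ^ (-i : ℝ)) := by
    filter_upwards [ae_pos_gammaMeasure_prod hν] with x hx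
    rw [← ENNReal.ofReal_mul (Real.rpow_nonneg hx.1.le _), Real.rpow_natCast,
      Real.rpow_neg hx.2.le, Real.rpow_natCast, div_pow, div_eq_mul_inv]
  rw [lintegral_congr_ae this, lintegral_prod_mul (f := fun x => ENNReal.ofReal (x ^ (i : ℝ)))
      (g := fun x => ENNReal.ofReal (x ^ (-i : ℝ))) (by fun_prop) (by fun_prop),
    lintegral_rpow_gammaMeasure (by norm_num) (by norm_num) h0,
    lintegral_rpow_gammaMeasure (by positivity) (by norm_num) (by linarith),
    ← ENNReal.ofReal_mul, ← gamma_ratio_eq_a hi]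
  · congr 1
    rw [Real.rpow_neg (by norm_num), ← sub_eq_add_neg]
    have : ((1 / 2 : ℝ) ^ (i : ℝ)) ≠ 0 := by positivity
    field_simp
  · have := Real.Gamma_pos_of_pos h0
    have := Real.Gamma_pos_of_pos (show (0 : ℝ) < 1 / 2 by norm_num)
    positivity

lemma a_pos {ν i : ℕ} (hi : (i : ℝ) < ν / 2) : 0 < a (ν + 1) i := by
  refine Finset.prod_pos fun l hl => ?_
  rw [Finset.mem_Icc] at hl
  have h1 : (1 : ℝ) ≤ l := by exact_mod_cast hl.1
  have h2 : (l : ℝ) ≤ i := by exact_mod_cast hl.2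
  rw [dof_succ]
  exact div_pos (by linarith) (by linarith)

lemma integrable_pow_ratioLaw {ν i : ℕ} (hν : 0 < ν) (hi : (i : ℝ) < ν / 2) :
    Integrable (fun r => r ^ i) (ratioLaw ν) := by
  refine ⟨by fun_prop, ?_⟩
  rw [hasFiniteIntegral_iff_ofReal, lintegral_pow_ratioLaw hν hi]
  · exact ENNReal.ofReal_lt_top
  · filter_upwards [ae_pos_ratioLaw hν] with r hr using pow_nonneg hr.le i

lemma integral_pow_ratioLaw {ν i : ℕ} (hν : 0 < ν) (hi : (i : ℝ) < ν / 2) :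
    ∫ r, r ^ i ∂ratioLaw ν = a (ν + 1) i := by
  rw [integral_eq_lintegral_of_nonneg_ae, lintegral_pow_ratioLaw hν hi,
    ENNReal.toReal_ofReal (a_pos hi).le]
  · filter_upwards [ae_pos_ratioLaw hν] with r hr using pow_nonneg hr.le i
  · fun_prop

/-- With `A / Q` distributed as `ratioLaw ν`, the left-hand side is the mean of
`Q ^ (-t) * (A + Q) ^ t`. Absorbing `Q ^ (-t)` into the gamma density of `Q` lowers its shape
by `t`, after which `A + Q` is again a gamma variable. -/
lemma lintegral_exp_mul_log_ratioLaw {ν : ℕ} (hν : 0 < ν) {t : ℝ} (ht : t < ν / 2) :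
    ∫⁻ r, ENNReal.ofReal (Real.exp (t * Real.log (1 + r))) ∂ratioLaw ν =
      ENNReal.ofReal (Real.Gamma (ν / 2 - t) / Real.Gamma (ν / 2) *
        (Real.Gamma ((ν + 1) / 2) / Real.Gamma ((ν + 1) / 2 - t))) := by
  have hν2 : (0 : ℝ) < ν / 2 := by positivity
  have htp : 0 < ν / 2 - t := sub_pos.2 ht
  have hh : (0 : ℝ) < 1 / 2 := by norm_num
  have := isProbabilityMeasure_gammaMeasure_half hh
  have := isProbabilityMeasure_gammaMeasure_half hν2
  have := isProbabilityMeasure_gammaMeasure_half htp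
  rw [ratioLaw, lintegral_map (by fun_prop) (by fun_prop)]
  have : ∀ᵐ x ∂(gammaMeasure (1 / 2) (1 / 2)).prod (gammaMeasure (ν / 2) (1 / 2)),
      ENNReal.ofReal (Real.exp (t * Real.log (1 + x.1 / x.2))) =
        ENNReal.ofReal (x.2 ^ (-t) * Real.exp (0 * x.2)) * ENNReal.ofReal ((x.1 + x.2) ^ t) := by
    filter_upwards [ae_pos_gammaMeasure_prod hν] with x ⟨hx, hy⟩
    rw [← ENNReal.ofReal_mul (by positivity), zero_mul, Real.exp_zero, mul_one, mul_comm t,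
      ← Real.rpow_def_of_pos (by positivity), Real.rpow_neg hy.le, inv_mul_eq_div,
      ← Real.div_rpow (by positivity) hy.le, add_div, div_self hy.ne', add_comm]
  rw [lintegral_congr_ae this, lintegral_prod _ (Measurable.aemeasurable (by fun_prop))]
  have hinner (x : ℝ) := lintegral_rpow_mul_exp_gammaMeasure hν2 hh (s := -t) (by linarith) hh
    (f := fun y => ENNReal.ofReal ((x + y) ^ t)) (by fun_prop)
  simp only [sub_zero, ← sub_eq_add_neg] at hinner
  simp_rw [hinner]
  rw [lintegral_const_mul' _ _ ENNReal.ofReal_ne_top,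
    ← lintegral_prod (fun x : ℝ × ℝ => ENNReal.ofReal ((x.1 + x.2) ^ t))
      (Measurable.aemeasurable (by fun_prop)),
    ← lintegral_map (f := fun y => ENNReal.ofReal (y ^ t)) (g := fun x : ℝ × ℝ => x.1 + x.2)
      (by fun_prop) (by fun_prop),
    map_add_gammaMeasure hh htp hh, lintegral_rpow_gammaMeasure (by linarith) hh (by linarith),
    ← ENNReal.ofReal_mul]
  · congr 1
    have h1 : (1 / 2 + (ν / 2 - t) + t : ℝ) = (ν + 1) / 2 := by ring
    have h2 : (1 / 2 + (ν / 2 - t) : ℝ) = (ν + 1) / 2 - t := by ring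
    have h3 : ((1 / 2 : ℝ)) ^ ((ν : ℝ) / 2) = (1 / 2) ^ ((ν : ℝ) / 2 - t) * (1 / 2) ^ t := by
      rw [← Real.rpow_add hh]; ring_nf
    rw [h1, h2, h3]
    have : (1 / 2 : ℝ) ^ t ≠ 0 := by positivity
    have : (1 / 2 : ℝ) ^ ((ν : ℝ) / 2 - t) ≠ 0 := by positivity
    field_simp
  · have := Real.Gamma_pos_of_pos htp
    have := Real.Gamma_pos_of_pos hν2
    positivity

lemma gamma_quotient_pos {ν : ℕ} (hν : 0 < ν) {t : ℝ} (ht : t < ν / 2) :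
    0 < Real.Gamma (ν / 2 - t) / Real.Gamma (ν / 2) *
        (Real.Gamma ((ν + 1) / 2) / Real.Gamma ((ν + 1) / 2 - t)) := by
  have := Real.Gamma_pos_of_pos (show (0 : ℝ) < ν / 2 - t by linarith)
  have := Real.Gamma_pos_of_pos (show (0 : ℝ) < ν / 2 by positivity)
  have := Real.Gamma_pos_of_pos (show (0 : ℝ) < (ν + 1) / 2 by positivity)
  have := Real.Gamma_pos_of_pos (show (0 : ℝ) < (ν + 1) / 2 - t by linarith)
  positivity

lemma integrable_exp_mul_log_ratioLaw {ν : ℕ} (hν : 0 < ν) {t : ℝ} (ht : t < ν / 2) :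
    Integrable (fun r => Real.exp (t * Real.log (1 + r))) (ratioLaw ν) := by
  refine ⟨Measurable.aestronglyMeasurable (by fun_prop), ?_⟩
  rw [hasFiniteIntegral_iff_ofReal (ae_of_all _ fun _ => (Real.exp_pos _).le),
    lintegral_exp_mul_log_ratioLaw hν ht]
  exact ENNReal.ofReal_lt_top

lemma mgf_log_ratioLaw {ν : ℕ} (hν : 0 < ν) {t : ℝ} (ht : t < ν / 2) :
    mgf (fun r => Real.log (1 + r)) (ratioLaw ν) t =
      Real.Gamma (ν / 2 - t) / Real.Gamma (ν / 2) *
        (Real.Gamma ((ν + 1) / 2) / Real.Gamma ((ν + 1) / 2 - t)) := by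
  rw [mgf, integral_eq_lintegral_of_nonneg_ae (ae_of_all _ fun _ => (Real.exp_pos _).le)
    (Measurable.aestronglyMeasurable (by fun_prop)), lintegral_exp_mul_log_ratioLaw hν ht,
    ENNReal.toReal_ofReal (gamma_quotient_pos hν ht).le]

lemma zero_mem_interior_integrableExpSet_log {ν : ℕ} (hν : 0 < ν) :
    0 ∈ interior (integrableExpSet (fun r => Real.log (1 + r)) (ratioLaw ν)) :=
  interior_maximal (fun _ ht => integrable_exp_mul_log_ratioLaw hν ht) isOpen_Iio
    (show (0 : ℝ) < ν / 2 by positivity)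

lemma hasDerivAt_log_Gamma_const_sub {c t : ℝ} (h : t < c) :
    HasDerivAt (fun t => Real.log (Real.Gamma (c - t))) (-digamma (c - t)) t := by
  have h0 : 0 < c - t := sub_pos.2 h
  have hG : HasDerivAt Real.Gamma (deriv Real.Gamma (c - t)) (c - t) :=
    (Real.differentiableAt_Gamma fun m => by
      have : (0 : ℝ) ≤ m := Nat.cast_nonneg m
      linarith).hasDerivAt
  have := (hG.log (Real.Gamma_pos_of_pos h0).ne').comp_const_sub c t
  simpa [digamma] using this

/-- The derivative is `D (ν - 2 t)` on a neighborhood of `0`, so the variance of `log (1 + r)` is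
`-2 D' ν` without a separate proof that the digamma function is differentiable. -/
lemma deriv_cgf_log_ratioLaw {ν : ℕ} (hν : 0 < ν) {t : ℝ} (ht : t < ν / 2) :
    deriv (cgf (fun r => Real.log (1 + r)) (ratioLaw ν)) t = D (ν - 2 * t) := by
  have hev : cgf (fun r => Real.log (1 + r)) (ratioLaw ν) =ᶠ[𝓝 t] fun t =>
      Real.log (Real.Gamma (ν / 2 - t)) - Real.log (Real.Gamma ((ν + 1) / 2 - t)) +
        (Real.log (Real.Gamma ((ν + 1) / 2)) - Real.log (Real.Gamma (ν / 2))) := by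
    filter_upwards [Iio_mem_nhds ht] with u hu
    have hu : u < ν / 2 := hu
    have h1 := (Real.Gamma_pos_of_pos (show (0 : ℝ) < ν / 2 - u by linarith)).ne'
    have h2 := (Real.Gamma_pos_of_pos (show (0 : ℝ) < ν / 2 by positivity)).ne'
    have h3 := (Real.Gamma_pos_of_pos (show (0 : ℝ) < (ν + 1) / 2 by positivity)).ne'
    have h4 := (Real.Gamma_pos_of_pos (show (0 : ℝ) < (ν + 1) / 2 - u by linarith)).ne'
    rw [cgf, mgf_log_ratioLaw hν hu, Real.log_mul (div_ne_zero h1 h2) (div_ne_zero h3 h4),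
      Real.log_div h1 h2, Real.log_div h3 h4]
    ring
  rw [hev.deriv_eq, (((hasDerivAt_log_Gamma_const_sub ht).fun_sub
    (hasDerivAt_log_Gamma_const_sub (by linarith))).add_const _).deriv, D]
  ring_nf

lemma integral_log_ratioLaw {ν : ℕ} (hν : 0 < ν) :
    ∫ r, Real.log (1 + r) ∂ratioLaw ν = D ν := by
  have := isProbabilityMeasure_ratioLaw hν
  have h := deriv_cgf_zero (zero_mem_interior_integrableExpSet_log hν)
  rw [deriv_cgf_log_ratioLaw hν (by positivity)] at h
  simpa using h.symm

lemma integral_sq_log_sub_ratioLaw {ν : ℕ} (hν : 0 < ν) :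
    ∫ r, (Real.log (1 + r) - D ν) ^ 2 ∂ratioLaw ν = -2 * deriv D ν := by
  have := isProbabilityMeasure_ratioLaw hν
  have h := iteratedDeriv_two_cgf_eq_integral (zero_mem_interior_integrableExpSet_log hν)
  have hev : deriv (cgf (fun r => Real.log (1 + r)) (ratioLaw ν)) =ᶠ[𝓝 0]
      fun t => D (ν - 2 * t) := by
    filter_upwards [Iio_mem_nhds (show (0 : ℝ) < ν / 2 by positivity)] with t ht
    exact deriv_cgf_log_ratioLaw hν ht
  rw [iteratedDeriv_succ, iteratedDeriv_one, hev.deriv_eq, hev.eq_of_nhds] at h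
  have h2 := deriv_comp_mul_left (2 : ℝ) (fun y => D (ν - y)) 0
  simp only [deriv_comp_const_sub, mul_zero, sub_zero, smul_eq_mul] at h2
  rw [h2] at h
  simp only [mul_zero, sub_zero, zero_mul, Real.exp_zero, mul_one, mgf_zero, div_one] at h
  linarith

/-- If `log (1 + r)` were almost surely constant, the mean of `(1 + r)⁻²` would be the square of
the mean of `(1 + r)⁻¹`. These means are `ν (ν + 2) / ((ν + 1) (ν + 3))` and `ν / (ν + 1)`. -/
lemma integral_sq_log_sub_ratioLaw_pos {ν : ℕ} (hν : 0 < ν) :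
    0 < ∫ r, (Real.log (1 + r) - D ν) ^ 2 ∂ratioLaw ν := by
  have := isProbabilityMeasure_ratioLaw hν
  have h2 : MemLp (fun r => Real.log (1 + r)) 2 (ratioLaw ν) :=
    memLp_of_mem_interior_integrableExpSet (zero_mem_interior_integrableExpSet_log hν) 2
  have hint : Integrable (fun r => (Real.log (1 + r) - D ν) ^ 2) (ratioLaw ν) :=
    (h2.sub (memLp_const _)).integrable_sq
  refine lt_of_le_of_ne (integral_nonneg fun _ => sq_nonneg _) fun h => ?_
  have hae : (fun r => Real.log (1 + r)) =ᵐ[ratioLaw ν] fun _ => D ν := by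
    filter_upwards [(integral_eq_zero_iff_of_nonneg (fun _ => sq_nonneg _) hint).1 h.symm]
      with r hr
    exact sub_eq_zero.1 (pow_eq_zero_iff two_ne_zero |>.1 hr)
  have hm (t : ℝ) : mgf (fun r => Real.log (1 + r)) (ratioLaw ν) t = Real.exp (t * D ν) := by
    rw [mgf_congr hae]; simp
  have hν0 : (0 : ℝ) < ν := by exact_mod_cast hν
  have h1 := mgf_log_ratioLaw hν (t := -1) (by linarith)
  have h2 := mgf_log_ratioLaw hν (t := -2) (by linarith)
  have e1 : Real.Gamma (ν / 2 + 1) = ν / 2 * Real.Gamma (ν / 2) :=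
    Real.Gamma_add_one (by positivity)
  have e2 : Real.Gamma ((ν + 1) / 2 + 1) = (ν + 1) / 2 * Real.Gamma ((ν + 1) / 2) :=
    Real.Gamma_add_one (by positivity)
  have e3 : Real.Gamma (ν / 2 + 2) = (ν / 2 + 1) * (ν / 2 * Real.Gamma (ν / 2)) := by
    rw [← e1, ← Real.Gamma_add_one (by positivity)]; ring_nf
  have e4 : Real.Gamma ((ν + 1) / 2 + 2) =
      ((ν + 1) / 2 + 1) * ((ν + 1) / 2 * Real.Gamma ((ν + 1) / 2)) := by
    rw [← e2, ← Real.Gamma_add_one (by positivity)]; ring_nf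
  have g1 := (Real.Gamma_pos_of_pos (show (0 : ℝ) < ν / 2 by positivity)).ne'
  have g2 := (Real.Gamma_pos_of_pos (show (0 : ℝ) < (ν + 1) / 2 by positivity)).ne'
  have h3 : Real.exp (-2 * D ν) = Real.exp (-1 * D ν) ^ 2 := by
    rw [← Real.exp_nat_mul]; push_cast; ring_nf
  rw [hm, sub_neg_eq_add, sub_neg_eq_add] at h1 h2
  rw [h3, h1, e1, e2, e3, e4] at h2
  field_simp at h2
  nlinarith

/-! ### A central limit theorem for arrays -/

lemma norm_pow_sub_pow_le {z w : ℂ} (hz : ‖z‖ ≤ 1) (hw : ‖w‖ ≤ 1) (n : ℕ) :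
    ‖z ^ n - w ^ n‖ ≤ n * ‖z - w‖ := by
  induction n with
  | zero => simp
  | succ n ih =>
    have h : z ^ (n + 1) - w ^ (n + 1) = z * (z ^ n - w ^ n) + (z - w) * w ^ n := by ring
    have h1 : ‖z‖ * ‖z ^ n - w ^ n‖ ≤ 1 * (n * ‖z - w‖) := by gcongr
    have h2 : ‖z - w‖ * ‖w‖ ^ n ≤ ‖z - w‖ * 1 := by
      gcongr
      exact pow_le_one₀ (norm_nonneg _) hw
    calc ‖z ^ (n + 1) - w ^ (n + 1)‖ ≤ ‖z‖ * ‖z ^ n - w ^ n‖ + ‖z - w‖ * ‖w‖ ^ n := by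
          rw [h]
          exact (norm_add_le _ _).trans (by simp)
      _ ≤ (n + 1 : ℕ) * ‖z - w‖ := by push_cast; linarith

lemma norm_exp_mul_I_sub_le (x : ℝ) :
    ‖Complex.exp (x * Complex.I) - (1 + x * Complex.I - x ^ 2 / 2)‖ ≤ 4 * |x| ^ 3 := by
  have hn : ‖(x * Complex.I : ℂ)‖ = |x| := by simp
  have hI : (x * Complex.I : ℂ) ^ 2 = -x ^ 2 := by simp [mul_pow]
  have hx0 := abs_nonneg x
  rcases le_or_gt |x| 1 with h | h
  · have := Complex.exp_bound (x := x * Complex.I) (by rwa [hn]) (n := 3) (by norm_num)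
    rw [hn] at this
    simp only [Finset.sum_range_succ, Finset.sum_range_zero] at this
    norm_num [Nat.factorial, hI] at this
    calc _ = ‖Complex.exp (x * Complex.I) - (1 + x * Complex.I + -x ^ 2 / 2)‖ := by
          congr 1; ring
      _ ≤ |x| ^ 3 * (2 / 9) := this
      _ ≤ 4 * |x| ^ 3 := by nlinarith [pow_nonneg hx0 3]
  · have h1 : ‖(1 + x * Complex.I - x ^ 2 / 2 : ℂ)‖ ≤ 1 + |x| + |x| ^ 2 / 2 := by
      refine (norm_sub_le _ _).trans (add_le_add ((norm_add_le _ _).trans ?_) ?_) <;> simp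
    have h2 := norm_sub_le (Complex.exp (x * Complex.I)) (1 + x * Complex.I - x ^ 2 / 2)
    rw [Complex.norm_exp_ofReal_mul_I] at h2
    have h3 : |x| ≤ |x| ^ 3 := le_self_pow₀ h.le (by norm_num)
    have h4 : |x| ^ 2 ≤ |x| ^ 3 := pow_le_pow_right₀ h.le (by norm_num)
    linarith

lemma norm_charFun_sub_le {μ : Measure ℝ} [IsProbabilityMeasure μ]
    (h3 : Integrable (fun x => |x| ^ 3) μ) (h0 : ∫ x, x ∂μ = 0) (s : ℝ) :
    ‖charFun μ s - (1 - ((∫ x, x ^ 2 ∂μ) * s ^ 2 / 2 : ℝ))‖ ≤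
      4 * |s| ^ 3 * ∫ x, |x| ^ 3 ∂μ := by
  have hL : MemLp (fun x : ℝ => x) 3 μ := by
    refine (integrable_norm_rpow_iff (by fun_prop) (by norm_num) (by norm_num)).1 ?_
    refine h3.congr (ae_of_all _ fun x => ?_)
    simp only [ENNReal.toReal_ofNat, Real.norm_eq_abs]
    norm_cast
  have i1 : Integrable (fun x : ℝ => x) μ := hL.integrable (by norm_num)
  have i2 : Integrable (fun x : ℝ => x ^ 2) μ := (hL.mono_exponent (by norm_num)).integrable_sq
  have j1 : Integrable (fun x : ℝ => ((s * x : ℝ) : ℂ) * Complex.I) μ :=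
    (i1.const_mul s).ofReal.mul_const _
  have j2 : Integrable (fun x : ℝ => (((s * x) ^ 2 / 2 : ℝ) : ℂ)) μ := by
    simp_rw [mul_pow]
    exact ((i2.const_mul (s ^ 2)).div_const 2).ofReal
  have j3 : Integrable (fun x : ℝ => Complex.exp ((s * x : ℝ) * Complex.I)) μ := by
    refine Integrable.of_bound (C := 1) (by fun_prop) (ae_of_all _ fun x => ?_)
    rw [Complex.norm_exp_ofReal_mul_I]
  have e : charFun μ s - (1 - ((∫ x, x ^ 2 ∂μ) * s ^ 2 / 2 : ℝ)) =
      ∫ x, (Complex.exp ((s * x : ℝ) * Complex.I) -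
        (1 + ((s * x : ℝ) : ℂ) * Complex.I - ((s * x) ^ 2 / 2 : ℝ))) ∂μ := by
    have k1 : ∫ x, ((s * x : ℝ) : ℂ) * Complex.I ∂μ = 0 := by
      rw [integral_mul_const, integral_complex_ofReal, integral_const_mul, h0]; simp
    have k2 : ∫ x, (((s * x) ^ 2 / 2 : ℝ) : ℂ) ∂μ = ((∫ x, x ^ 2 ∂μ) * s ^ 2 / 2 : ℝ) := by
      rw [integral_complex_ofReal, integral_div]
      simp_rw [mul_pow]
      rw [integral_const_mul, mul_comm]
    have j4 : Integrable (fun x : ℝ => 1 + ((s * x : ℝ) : ℂ) * Complex.I) μ :=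
      (integrable_const _).add j1
    have j5 : Integrable (fun x : ℝ =>
        1 + ((s * x : ℝ) : ℂ) * Complex.I - (((s * x) ^ 2 / 2 : ℝ) : ℂ)) μ := j4.sub j2
    rw [integral_sub j3 j5, integral_sub j4 j2, integral_add (integrable_const _) j1, k1,
      k2, charFun_apply_real]
    simp
  rw [e]
  refine (norm_integral_le_integral_norm _).trans ?_
  rw [← integral_const_mul]
  refine integral_mono_of_nonneg (ae_of_all _ fun _ => norm_nonneg _) (h3.const_mul _)
    (ae_of_all _ fun x => ?_)
  have := norm_exp_mul_I_sub_le (s * x)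
  rw [abs_mul, mul_pow] at this
  push_cast at this ⊢
  linarith

/-- Lyapunov's form of the central limit theorem at the level of characteristic functions, for
identically distributed rows. -/
lemma tendsto_charFun_pow {lam : ℕ → Measure ℝ} [∀ m, IsProbabilityMeasure (lam m)] {p : ℕ → ℕ}
    (hp : Tendsto p atTop atTop) (h3 : ∀ᶠ m in atTop, Integrable (fun x => |x| ^ 3) (lam m))
    (h0 : ∀ᶠ m in atTop, ∫ x, x ∂lam m = 0)
    (h2 : Tendsto (fun m => ∫ x, x ^ 2 ∂lam m) atTop (𝓝 1)) {C : ℝ}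
    (hC : ∀ᶠ m in atTop, ∫ x, |x| ^ 3 ∂lam m ≤ C) (t : ℝ) :
    Tendsto (fun m => charFun (lam m) ((√(p m))⁻¹ * t) ^ p m) atTop
      (𝓝 (Complex.exp (-t ^ 2 / 2))) := by
  have hpR : Tendsto (fun m => (p m : ℝ)) atTop atTop := tendsto_natCast_atTop_atTop.comp hp
  have hsq : Tendsto (fun m => (√(p m))⁻¹) atTop (𝓝 0) :=
    tendsto_inv_atTop_zero.comp (Real.tendsto_sqrt_atTop.comp hpR)
  have hpinv : Tendsto (fun m => (p m : ℝ)⁻¹) atTop (𝓝 0) := tendsto_inv_atTop_zero.comp hpR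
  set v : ℕ → ℝ := fun m => ∫ x, x ^ 2 ∂lam m with hv
  have hv0 (m : ℕ) : 0 ≤ v m := integral_nonneg fun _ => sq_nonneg _
  -- `u m` is the second-order term of the characteristic function at `t / √p`.
  set u : ℕ → ℝ := fun m => v m * t ^ 2 / 2 * (p m : ℝ)⁻¹ with hu
  have hu0 (m : ℕ) : 0 ≤ u m := by have := hv0 m; positivity
  have hulim : Tendsto u atTop (𝓝 0) := by
    simpa using ((h2.mul_const (t ^ 2)).div_const 2).mul hpinv
  have hexp : Tendsto (fun m => (Real.exp (-u m) : ℂ) ^ p m) atTop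
      (𝓝 (Complex.exp (-t ^ 2 / 2))) := by
    have h1 : Tendsto (fun m => Real.exp (-(v m * t ^ 2 / 2))) atTop
        (𝓝 (Real.exp (-t ^ 2 / 2))) := by
      refine (Real.continuous_exp.tendsto _).comp ?_
      have := ((h2.mul_const (t ^ 2)).div_const 2).neg
      rwa [one_mul, ← neg_div] at this
    have h1' := (Complex.continuous_ofReal.tendsto _).comp h1
    have e1 : ((Real.exp (-t ^ 2 / 2) : ℝ) : ℂ) = Complex.exp (-t ^ 2 / 2) := by push_cast; rfl
    rw [e1] at h1'
    refine h1'.congr' ?_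
    filter_upwards [hp.eventually_gt_atTop 0] with m hm
    have : (p m : ℝ) ≠ 0 := by positivity
    rw [Function.comp_apply, ← Complex.ofReal_pow, ← Real.exp_nat_mul]
    congr 2
    simp only [hu]
    field_simp
  have hdiff : Tendsto (fun m => charFun (lam m) ((√(p m))⁻¹ * t) ^ p m -
      (Real.exp (-u m) : ℂ) ^ p m) atTop (𝓝 0) := by
    have hb : Tendsto (fun m => 4 * |t| ^ 3 * C * (√(p m))⁻¹ + v m * t ^ 2 / 2 * u m)
        atTop (𝓝 0) := by
      have := (hsq.const_mul (4 * |t| ^ 3 * C)).add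
        (((h2.mul_const (t ^ 2)).div_const 2).mul hulim)
      simpa using this
    refine squeeze_zero_norm' ?_ hb
    filter_upwards [h3, h0, hC, hp.eventually_gt_atTop 0,
      hulim.eventually (Iic_mem_nhds (show (0 : ℝ) < 1 by norm_num))] with m a3 a0 aC ap au
    have hp0 : (0 : ℝ) < p m := by exact_mod_cast ap
    have hs0 : 0 < √(p m) := Real.sqrt_pos.2 hp0
    have hss : √(p m) ^ 2 = p m := Real.sq_sqrt hp0.le
    have hw : ‖(Real.exp (-u m) : ℂ)‖ ≤ 1 := by
      rw [Complex.norm_real, Real.norm_eq_abs, abs_of_pos (Real.exp_pos _)]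
      exact Real.exp_le_one_iff.2 (neg_nonpos.2 (hu0 m))
    have b1 := norm_charFun_sub_le a3 a0 ((√(p m))⁻¹ * t)
    have e2 : (∫ x, x ^ 2 ∂lam m) * ((√(p m))⁻¹ * t) ^ 2 / 2 = u m := by
      simp only [hu, hv, mul_pow, inv_pow, hss]; ring
    rw [e2] at b1
    have b2 : ‖((1 - (u m : ℝ) : ℂ)) - (Real.exp (-u m) : ℂ)‖ ≤ u m ^ 2 := by
      have := Real.norm_exp_sub_one_sub_id_le (x := -u m) (by
        rw [norm_neg, Real.norm_eq_abs, abs_of_nonneg (hu0 m)]; exact au)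
      rw [norm_neg, Real.norm_eq_abs (u m), sq_abs] at this
      rw [← Complex.ofReal_one, ← Complex.ofReal_sub, ← Complex.ofReal_sub, Complex.norm_real,
        norm_sub_rev]
      convert! this using 2
      ring
    have b3 : 4 * |(√(p m))⁻¹ * t| ^ 3 * ∫ x, |x| ^ 3 ∂lam m ≤
        4 * |t| ^ 3 * C * (√(p m))⁻¹ * (p m : ℝ)⁻¹ := by
      have e3 : |(√(p m))⁻¹ * t| ^ 3 = |t| ^ 3 * (√(p m))⁻¹ * (p m : ℝ)⁻¹ := by
        rw [abs_mul, abs_of_pos (inv_pos.2 hs0), mul_pow, pow_succ (√(p m))⁻¹ 2, inv_pow, hss]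
        ring
      rw [e3]
      have : 0 ≤ 4 * (|t| ^ 3 * (√(p m))⁻¹ * (p m : ℝ)⁻¹) := by positivity
      nlinarith [mul_le_mul_of_nonneg_left aC this]
    calc _ ≤ p m * ‖charFun (lam m) ((√(p m))⁻¹ * t) - (Real.exp (-u m) : ℂ)‖ :=
          norm_pow_sub_pow_le (norm_charFun_le_one _) hw _
      _ ≤ p m * (4 * |t| ^ 3 * C * (√(p m))⁻¹ * (p m : ℝ)⁻¹ + u m ^ 2) := by
          gcongr
          refine (norm_sub_le_norm_sub_add_norm_sub _ (1 - (u m : ℝ) : ℂ) _).trans ?_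
          exact add_le_add (b1.trans b3) b2
      _ = 4 * |t| ^ 3 * C * (√(p m))⁻¹ + v m * t ^ 2 / 2 * u m := by
          simp only [hu]; field_simp
  simpa using hdiff.add hexp

/-- Central limit theorem for an array whose `m`-th row consists of `p m` independent variables of
law `lam m`, with mean `0`, variance tending to `1` and bounded third absolute moment. The shift `e`
absorbs a negligible error in the centering. -/
theorem tendstoInDistribution_sum_div_sqrt_add {Ω : ℕ → Type*} [∀ m, MeasurableSpace (Ω m)]
    {P : ∀ m, Measure (Ω m)} [∀ m, IsProbabilityMeasure (P m)] {p : ℕ → ℕ}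
    {lam : ℕ → Measure ℝ} [∀ m, IsProbabilityMeasure (lam m)] {U : ∀ m, Fin (p m) → Ω m → ℝ}
    (hlaw : ∀ m j, HasLaw (U m j) (lam m) (P m)) (hind : ∀ m, iIndepFun (U m) (P m))
    (hp : Tendsto p atTop atTop) (h3 : ∀ᶠ m in atTop, Integrable (fun x => |x| ^ 3) (lam m))
    (h0 : ∀ᶠ m in atTop, ∫ x, x ∂lam m = 0)
    (h2 : Tendsto (fun m => ∫ x, x ^ 2 ∂lam m) atTop (𝓝 1)) {C : ℝ}
    (hC : ∀ᶠ m in atTop, ∫ x, |x| ^ 3 ∂lam m ≤ C) {e : ℕ → ℝ} (he : Tendsto e atTop (𝓝 0)) :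
    TendstoInDistribution (fun m ω => (√(p m))⁻¹ * ∑ j, U m j ω + e m) atTop (id : ℝ → ℝ) P
      (gaussianReal 0 1) where
  forall_aemeasurable m := by
    have (j : Fin (p m)) := (hlaw m j).aemeasurable
    fun_prop
  tendsto := by
    refine ProbabilityMeasure.tendsto_iff_tendsto_charFun.2 fun t => ?_
    have hm (m : ℕ) : AEMeasurable (fun ω => ∑ j, U m j ω) (P m) := by
      have (j : Fin (p m)) := (hlaw m j).aemeasurable
      fun_prop
    have key (m : ℕ) : charFun ((P m).map (fun ω => (√(p m))⁻¹ * ∑ j, U m j ω + e m)) t =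
        charFun (lam m) ((√(p m))⁻¹ * t) ^ p m * Complex.exp (t * e m * Complex.I) := by
      have : (P m).map (fun ω => (√(p m))⁻¹ * ∑ j, U m j ω + e m) =
          ((P m).map (fun ω => (√(p m))⁻¹ * ∑ j, U m j ω)).map (· + e m) := by
        rw [AEMeasurable.map_map_of_aemeasurable (by fun_prop) ((hm m).const_mul _)]
        rfl
      rw [this, charFun_map_add_const, charFun_map_mul_comp (hm m),
        (hind m).charFun_map_fun_sum_eq_prod (fun j => (hlaw m j).aemeasurable)]
      simp only [(hlaw m _).map_eq]
      simp [mul_comm]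
    simp only [ProbabilityMeasure.coe_mk, key, Measure.map_id]
    have h1 : Tendsto (fun m => Complex.exp (t * e m * Complex.I)) atTop (𝓝 1) := by
      have : Tendsto (fun m => (t * e m * Complex.I : ℂ)) atTop (𝓝 0) := by
        have h := (Complex.continuous_ofReal.tendsto _).comp he
        simpa using (h.const_mul (t : ℂ)).mul_const Complex.I
      simpa [Function.comp_def] using (Complex.continuous_exp.tendsto _).comp this
    have := (tendsto_charFun_pow hp h3 h0 h2 hC t).mul h1
    simpa [charFun_gaussianReal, neg_div] using this

/-! ### From the normal sample to independent Student statistics -/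

/-- `n x̄² / ∑ (xᵢ - x̄)²`, the ratio of the two terms in the decomposition of `∑ xᵢ²` along the
direction of the constant vectors and its orthogonal complement. -/
noncomputable def meanRatio {n : ℕ} (c : Fin n → ℝ) : ℝ :=
  n * ((∑ i, c i) / n) ^ 2 / ∑ i, (c i - (∑ i, c i) / n) ^ 2

lemma measurable_meanRatio {n : ℕ} : Measurable (meanRatio (n := n)) := by
  unfold meanRatio
  fun_prop

lemma meanRatio_const_mul {n : ℕ} {σ : ℝ} (hσ : σ ≠ 0) (c : Fin n → ℝ) :
    meanRatio (fun i => σ * c i) = meanRatio c := by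
  have h (i : Fin n) : (σ * c i - σ * ((∑ i, c i) / n)) ^ 2 =
      σ ^ 2 * (c i - (∑ i, c i) / n) ^ 2 := by ring
  simp only [meanRatio, ← Finset.mul_sum, mul_div_assoc σ, h]
  rw [show (n : ℝ) * (σ * ((∑ i, c i) / n)) ^ 2 = σ ^ 2 * (n * ((∑ i, c i) / n) ^ 2) by ring,
    mul_div_mul_left _ _ (pow_ne_zero 2 hσ)]

lemma tStat_sq_div_dof {ν p : ℕ} (hν : 0 < ν) (μ₀ : EuclideanSpace ℝ (Fin p))
    (x : Fin (ν + 1) → EuclideanSpace ℝ (Fin p)) (j : Fin p) :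
    tStat μ₀ x j ^ 2 / dof (ν + 1) = meanRatio (fun i => x i j - μ₀ j) := by
  have hν0 : (0 : ℝ) < ν := by exact_mod_cast hν
  have hm : (∑ i, (x i j - μ₀ j)) / ((ν + 1 : ℕ) : ℝ) = sampleMean x j - μ₀ j := by
    rw [sampleMean, Finset.sum_sub_distrib, sub_div]
    have : (ν + 1 : ℝ) ≠ 0 := by positivity
    simp [mul_div_cancel_left₀ _ this]
  have hs : 0 ≤ sampleVariance x j := by
    rw [sampleVariance, dof_succ]; positivity
  rw [meanRatio, hm, tStat, div_pow, mul_pow, Real.sq_sqrt hs, Real.sq_sqrt (by positivity),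
    sampleVariance, dof_succ, div_div, div_mul_cancel₀ _ hν0.ne']
  simp

/-- In orthonormal coordinates whose first axis is the direction of the constant vectors,
`meanRatio` is the squared first coordinate over the sum of squares of the others. -/
lemma meanRatio_orthonormalBasis {ν : ℕ}
    (b : OrthonormalBasis (Fin (ν + 1)) ℝ (EuclideanSpace ℝ (Fin (ν + 1))))
    (hb : b 0 = WithLp.toLp 2 fun _ => (√((ν + 1 : ℕ) : ℝ))⁻¹) (z : Fin (ν + 1) → ℝ) :
    meanRatio (fun i => (∑ k, z k • b k) i) = z 0 ^ 2 / ∑ k : Fin ν, z k.succ ^ 2 := by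
  set n : ℝ := ((ν + 1 : ℕ) : ℝ) with hn
  have hn0 : 0 < n := by positivity
  set x := ∑ k, z k • b k with hx
  have h0 : inner ℝ (b 0) x = z 0 := by
    rw [hx, inner_sum]
    simp [inner_smul_right, orthonormal_iff_ite.1 b.orthonormal]
  have h1 : inner ℝ (b 0) x = (∑ i, x i) * (√n)⁻¹ := by
    rw [hb, PiLp.inner_apply, Finset.sum_mul]
    simp
  have hsum : (∑ i, x i) ^ 2 = n * z 0 ^ 2 := by
    rw [← h0, h1, mul_pow, inv_pow, Real.sq_sqrt hn0.le]
    field_simp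
  have hnorm : ∑ i, x i ^ 2 = ∑ k, z k ^ 2 := by
    rw [← EuclideanSpace.real_norm_sq_eq, ← b.sum_sq_norm_inner_right x]
    refine Finset.sum_congr rfl fun k _ => ?_
    rw [Real.norm_eq_abs, sq_abs, hx, inner_sum]
    simp [inner_smul_right, orthonormal_iff_ite.1 b.orthonormal]
  have hden : ∑ i, (x i - (∑ i, x i) / n) ^ 2 = ∑ k : Fin ν, z k.succ ^ 2 := by
    have : ∑ i, (x i - (∑ i, x i) / n) ^ 2 = ∑ i, x i ^ 2 - (∑ i, x i) ^ 2 / n := by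
      simp only [sub_sq, Finset.sum_add_distrib, Finset.sum_sub_distrib, ← Finset.sum_mul,
        ← Finset.mul_sum, Finset.sum_const, Finset.card_univ, Fintype.card_fin, nsmul_eq_mul,
        ← hn]
      field_simp
      ring
    rw [this, hsum, hnorm, Fin.sum_univ_succ, mul_div_cancel_left₀ _ hn0.ne', add_sub_cancel_left]
  rw [meanRatio, ← hn, hden, div_pow, hsum]
  congr 1
  field_simp

lemma exists_orthonormalBasis_const (ν : ℕ) :
    ∃ b : OrthonormalBasis (Fin (ν + 1)) ℝ (EuclideanSpace ℝ (Fin (ν + 1))),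
      b 0 = WithLp.toLp 2 fun _ => (√((ν + 1 : ℕ) : ℝ))⁻¹ := by
  set v : EuclideanSpace ℝ (Fin (ν + 1)) := WithLp.toLp 2 fun _ => (√((ν + 1 : ℕ) : ℝ))⁻¹
    with hv
  have hnorm : ‖v‖ = 1 := by
    have : ‖v‖ ^ 2 = 1 := by
      rw [EuclideanSpace.real_norm_sq_eq]
      simp only [hv, inv_pow, Real.sq_sqrt (Nat.cast_nonneg (ν + 1))]
      rw [Finset.sum_const, Finset.card_univ, Fintype.card_fin, nsmul_eq_mul,
        mul_inv_cancel₀ (by positivity)]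
    nlinarith [norm_nonneg v]
  have ho : Orthonormal ℝ (({0} : Set (Fin (ν + 1))).domRestrict fun _ => v) :=
    ⟨fun _ => hnorm, fun i j hij => absurd (Subsingleton.elim i j) hij⟩
  obtain ⟨b, hb⟩ := ho.exists_orthonormalBasis_extension_of_card_eq (by simp)
  exact ⟨b, hb 0 rfl⟩

lemma map_sq_gaussianReal :
    (gaussianReal 0 1).map (fun x => x ^ 2) = gammaMeasure (1 / 2) (1 / 2) := by
  have h := map_sum_sq_pi_gaussianReal one_pos
  rw [← (measurePreserving_eval (fun _ : Fin 1 => gaussianReal 0 1) 0).map_eq,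
    Measure.map_map (by fun_prop) (by fun_prop)]
  simpa [Function.comp_def] using h

/-- For independent standard normal `z₀, …, z_ν`, this is the law of
`z₀² / (z₁² + ⋯ + z_ν²)`. -/
lemma map_sq_div_sum_sq_pi_gaussianReal {ν : ℕ} (hν : 0 < ν) :
    (Measure.pi fun _ : Fin (ν + 1) => gaussianReal 0 1).map
      (fun z => z 0 ^ 2 / ∑ k : Fin ν, z k.succ ^ 2) = ratioLaw ν := by
  have hmp := measurePreserving_piFinSuccAbove (fun _ : Fin (ν + 1) => gaussianReal 0 1) 0
  rw [ratioLaw, ← map_sq_gaussianReal, ← map_sum_sq_pi_gaussianReal hν,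
    Measure.map_prod_map _ _ (by fun_prop) (by fun_prop), ← hmp.map_eq,
    Measure.map_map (by fun_prop) hmp.measurable, Measure.map_map (by fun_prop)
      (Measurable.comp (by fun_prop) hmp.measurable)]
  rfl

/-- The mean ratio of a standard normal sample has law `ratioLaw ν`, by invariance of the standard
Gaussian measure under rotations. -/
lemma map_meanRatio_pi_gaussianReal {ν : ℕ} (hν : 0 < ν) :
    (Measure.pi fun _ : Fin (ν + 1) => gaussianReal 0 1).map meanRatio = ratioLaw ν := by
  obtain ⟨b, hb⟩ := exists_orthonormalBasis_const ν
  have h := stdGaussian_eq_map_pi_orthonormalBasis b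
  rw [← map_pi_eq_stdGaussian] at h
  have hm : Measurable fun x : EuclideanSpace ℝ (Fin (ν + 1)) => meanRatio fun i => x i :=
    measurable_meanRatio.comp (by fun_prop)
  have h' := congrArg (Measure.map fun x => meanRatio fun i => x i) h
  rw [Measure.map_map hm (by fun_prop), Measure.map_map hm (by fun_prop)] at h'
  rw [← map_sq_div_sum_sq_pi_gaussianReal hν]
  refine Eq.trans ?_ (h'.trans ?_)
  · rfl
  · congr 1
    ext z
    exact meanRatio_orthonormalBasis b hb z

lemma hasLaw_meanRatio_sub {ν : ℕ} (hν : 0 < ν) (c : ℝ) {v : NNReal} (hv : v ≠ 0) :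
    HasLaw (fun x : Fin (ν + 1) → ℝ => meanRatio fun i => x i - c) (ratioLaw ν)
      (Measure.pi fun _ => gaussianReal c v) where
  aemeasurable := (measurable_meanRatio.comp (by fun_prop)).aemeasurable
  map_eq := by
    have hσ : √(v : ℝ) ≠ 0 := (Real.sqrt_pos.2 (by positivity)).ne'
    have h1 : (gaussianReal 0 1).map (fun z => √(v : ℝ) * z + c) = gaussianReal c v := by
      rw [← Function.comp_def (fun z => z + c) (fun z => √(v : ℝ) * z),
        ← Measure.map_map (by fun_prop) (by fun_prop), gaussianReal_map_const_mul,
        gaussianReal_map_add_const]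
      congr 1
      · simp
      · ext; simp
    have h2 : (Measure.pi fun _ : Fin (ν + 1) => gaussianReal c v) =
        (Measure.pi fun _ : Fin (ν + 1) => gaussianReal 0 1).map
          (fun z i => √(v : ℝ) * z i + c) := by
      have : ∀ _ : Fin (ν + 1), SigmaFinite ((gaussianReal 0 1).map fun z => √(v : ℝ) * z + c) := by
        rw [h1]; infer_instance
      rw [Measure.pi_map_pi (μ := fun _ : Fin (ν + 1) => gaussianReal 0 1)
        (f := fun _ z => √(v : ℝ) * z + c) (fun _ => by fun_prop)]
      simp_rw [h1]
    have h3 : Measurable fun x : Fin (ν + 1) → ℝ => meanRatio fun i => x i - c :=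
      measurable_meanRatio.comp (by fun_prop)
    rw [h2, Measure.map_map h3 (by fun_prop),
      ← map_meanRatio_pi_gaussianReal hν]
    congr 1
    ext z
    simp only [Function.comp_apply, add_sub_cancel_right]
    exact meanRatio_const_mul hσ z

section Sample

variable {Ω : Type*} [MeasurableSpace Ω] {P : Measure Ω} {n p : ℕ}
  {X : Fin n → Ω → EuclideanSpace ℝ (Fin p)} {μ : EuclideanSpace ℝ (Fin p)}
  {S : Matrix (Fin p) (Fin p) ℝ}

lemma IsNormalSample.hasLaw_entry (hX : IsNormalSample P X μ S) (hS : S.PosSemidef) (i : Fin n)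
    (j : Fin p) : HasLaw (fun ω => X i ω j) (gaussianReal (μ j) (S j j).toNNReal) P :=
  (measurePreserving_eval_multivariateGaussian hS).hasLaw.comp (hX.2 i)

/-- The data matrix is jointly Gaussian with pairwise uncorrelated columns. -/
lemma IsNormalSample.iIndepFun_columns (hX : IsNormalSample P X μ S) (hS : S.PosSemidef)
    (hdiag : S.IsDiag) : iIndepFun (fun (j : Fin p) ω (i : Fin n) => X i ω j) P := by
  have hG : HasGaussianLaw (fun ω i => X i ω) P :=
    hX.1.hasGaussianLaw fun i => (hX.2 i).hasGaussianLaw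
  let L : (Fin n → EuclideanSpace ℝ (Fin p)) →L[ℝ] (Fin p → Fin n → ℝ) :=
    .pi fun j => .pi fun i => (EuclideanSpace.proj j : EuclideanSpace ℝ (Fin p) →L[ℝ] ℝ).comp
      (.proj i)
  have hG' : HasGaussianLaw (fun ω j i => X i ω j) P := hG.map_fun L
  refine HasGaussianLaw.iIndepFun_of_covariance_eval (X := fun j i ω => X i ω j) hG' ?_
  intro j k hjk i l
  by_cases hil : i = l
  · subst hil
    have := (hX.2 i).covariance_fun_comp (f := fun x => x j) (g := fun x => x k)
      (Measurable.aemeasurable (by fun_prop)) (Measurable.aemeasurable (by fun_prop))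
    rw [this, covariance_eval_multivariateGaussian hS, hdiag hjk]
  · have hmem (i : Fin n) (j : Fin p) : MemLp (fun ω => X i ω j) 2 P :=
      (hX.hasLaw_entry hS i j).hasGaussianLaw.memLp_two
    have hind : IndepFun (fun ω => X i ω j) (fun ω => X l ω k) P :=
      (hX.1.indepFun hil).comp (φ := fun x : EuclideanSpace ℝ (Fin p) => x j)
        (ψ := fun x : EuclideanSpace ℝ (Fin p) => x k) (by fun_prop) (by fun_prop)
    exact hind.covariance_eq_zero (hmem i j) (hmem l k)

end Sample

section Student

variable {Ω : Type*} [MeasurableSpace Ω] {P : Measure Ω} {ν p : ℕ}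
  {X : Fin (ν + 1) → Ω → EuclideanSpace ℝ (Fin p)} {μ : EuclideanSpace ℝ (Fin p)}
  {S : Matrix (Fin p) (Fin p) ℝ}

lemma IsNormalSample.iIndepFun_tStat_sq (hν : 0 < ν) (hX : IsNormalSample P X μ S)
    (hS : S.PosSemidef) (hdiag : S.IsDiag) :
    iIndepFun (fun j ω => tStat μ (fun i => X i ω) j ^ 2 / dof (ν + 1)) P := by
  simp_rw [tStat_sq_div_dof hν]
  exact (hX.iIndepFun_columns hS hdiag).comp (fun j x => meanRatio fun i => x i - μ j)
    fun j => measurable_meanRatio.comp (by fun_prop)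

lemma IsNormalSample.hasLaw_tStat_sq (hν : 0 < ν) (hX : IsNormalSample P X μ S)
    (hS : S.PosDef) (j : Fin p) :
    HasLaw (fun ω => tStat μ (fun i => X i ω) j ^ 2 / dof (ν + 1)) (ratioLaw ν) P := by
  simp_rw [tStat_sq_div_dof hν]
  have hv : (S j j).toNNReal ≠ 0 := (Real.toNNReal_pos.2 hS.diag_pos).ne'
  have hind : iIndepFun (fun i ω => X i ω j) P :=
    hX.1.comp (fun _ x => x j) fun _ => by fun_prop
  exact (hasLaw_meanRatio_sub hν (μ j) hv).comp
    (hind.hasLaw_pi fun i => hX.hasLaw_entry hS.posSemidef i j)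

end Student

/-! ### Asymptotics for large samples -/

/-- The difference vanishes at `0`, and its derivative `(-y) ^ k / (1 + y)` is at most `y ^ k` in
absolute value. -/
lemma abs_log_one_add_sub_sum_le {x : ℝ} (hx : 0 ≤ x) (k : ℕ) :
    |Real.log (1 + x) - ∑ i ∈ Finset.Icc 1 k, (-1 : ℝ) ^ (i + 1) * x ^ i / i| ≤
      x ^ (k + 1) / (k + 1) := by
  have hd (y : ℝ) (hy : 0 ≤ y) : HasDerivAt (fun y => Real.log (1 + y) -
      ∑ i ∈ Finset.Icc 1 k, (-1 : ℝ) ^ (i + 1) * y ^ i / i) ((-y) ^ k / (1 + y)) y := by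
    have h1 : HasDerivAt (fun y => Real.log (1 + y)) (1 / (1 + y)) y :=
      ((hasDerivAt_id y).const_add 1).log (by simp only [id]; positivity)
    have h2 : HasDerivAt (fun y : ℝ => ∑ i ∈ Finset.Icc 1 k, (-1 : ℝ) ^ (i + 1) * y ^ i / i)
        (∑ i ∈ Finset.range k, (-y) ^ i) y := by
      have hsum : ∑ i ∈ Finset.Icc 1 k, (-1 : ℝ) ^ (i + 1) * (i * y ^ (i - 1)) / i =
          ∑ i ∈ Finset.range k, (-y) ^ i := by
        rw [← Finset.Ico_add_one_right_eq_Icc, Finset.range_eq_Ico, ← Finset.sum_Ico_add' _ 0 k 1]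
        refine Finset.sum_congr rfl fun i _ => ?_
        have : ((i + 1 : ℕ) : ℝ) ≠ 0 := by positivity
        rw [Nat.add_sub_cancel, neg_pow y i]
        field_simp
        ring
      rw [← hsum]
      exact HasDerivAt.fun_sum fun i _ => ((hasDerivAt_pow i y).const_mul _).div_const _
    convert! h1.sub h2 using 1
    rw [geom_sum_eq (by linarith)]
    have : 1 + y ≠ 0 := by positivity
    have : -y - 1 ≠ 0 := by linarith
    field_simp
    ring
  have hB (y : ℝ) : HasDerivAt (fun y : ℝ => y ^ (k + 1) / (k + 1)) (y ^ k) y := by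
    convert! (hasDerivAt_pow (k + 1) y).div_const ((k : ℝ) + 1) using 1
    push_cast
    field_simp
  have := image_norm_le_of_norm_deriv_right_le_deriv_boundary (a := 0) (b := x)
    (f := fun y => Real.log (1 + y) - ∑ i ∈ Finset.Icc 1 k, (-1 : ℝ) ^ (i + 1) * y ^ i / i)
    (f' := fun y => (-y) ^ k / (1 + y)) (B := fun y : ℝ => y ^ (k + 1) / (k + 1))
    (B' := fun y => y ^ k)
    (fun y hy => (hd y hy.1).continuousAt.continuousWithinAt)
    (fun y hy => (hd y hy.1).hasDerivWithinAt) ?_ hB ?_ ⟨hx, le_rfl⟩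
  · simpa using this
  · rw [Finset.sum_eq_zero]
    · simp
    · intro i hi
      have : i ≠ 0 := by rw [Finset.mem_Icc] at hi; lia
      simp [this]
  · intro y hy
    have hy0 : 0 ≤ y := hy.1
    rw [norm_div, norm_pow, norm_neg, Real.norm_of_nonneg hy0, Real.norm_of_nonneg (by linarith)]
    exact div_le_self (by positivity) (by linarith)

lemma memLp_log_ratioLaw {ν : ℕ} (hν : 0 < ν) (q : NNReal) :
    MemLp (fun r => Real.log (1 + r)) q (ratioLaw ν) :=
  memLp_of_mem_interior_integrableExpSet (zero_mem_interior_integrableExpSet_log hν) q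

lemma integrable_log_pow_ratioLaw {ν : ℕ} (hν : 0 < ν) (i : ℕ) :
    Integrable (fun r => Real.log (1 + r) ^ i) (ratioLaw ν) :=
  integrable_pow_of_mem_interior_integrableExpSet (zero_mem_interior_integrableExpSet_log hν) i

lemma integrable_abs_log_sub_pow_ratioLaw {ν : ℕ} (hν : 0 < ν) (d : ℝ) :
    Integrable (fun r => |Real.log (1 + r) - d| ^ 3) (ratioLaw ν) := by
  have := isProbabilityMeasure_ratioLaw hν
  exact ((memLp_log_ratioLaw hν 3).sub (memLp_const d)).integrable_norm_pow (by norm_num)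

/-- The expansion of the logarithm, integrated against `ratioLaw ν`. -/
lemma abs_mul_D_sub_ξ_le {ν k : ℕ} (hν : 0 < ν) (hk : ((k + 1 : ℕ) : ℝ) < ν / 2) :
    |((ν + 1 : ℕ) : ℝ) * D ν - ξ (ν + 1) k| ≤ ((ν + 1 : ℕ) : ℝ) * a (ν + 1) (k + 1) := by
  have hi {i : ℕ} (h : i ≤ k + 1) : (i : ℝ) < ν / 2 := lt_of_le_of_lt (by exact_mod_cast h) hk
  have hterm (i : ℕ) (h : i ∈ Finset.Icc 1 k) :
      Integrable (fun r => (-1 : ℝ) ^ (i + 1) * r ^ i / i) (ratioLaw ν) :=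
    ((integrable_pow_ratioLaw hν (hi (by rw [Finset.mem_Icc] at h; lia))).const_mul _).div_const _
  have hlog : Integrable (fun r => Real.log (1 + r)) (ratioLaw ν) := by
    simpa using integrable_log_pow_ratioLaw hν 1
  have e : D ν - ∑ i ∈ Finset.Icc 1 k, (-1 : ℝ) ^ (i + 1) * a (ν + 1) i / i =
      ∫ r, (Real.log (1 + r) - ∑ i ∈ Finset.Icc 1 k, (-1 : ℝ) ^ (i + 1) * r ^ i / i)
        ∂ratioLaw ν := by
    rw [integral_sub hlog (integrable_finsetSum _ hterm), integral_log_ratioLaw hν,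
      integral_finsetSum _ hterm]
    congr 1
    refine Finset.sum_congr rfl fun i h => ?_
    rw [integral_div, integral_const_mul,
      integral_pow_ratioLaw hν (hi (by rw [Finset.mem_Icc] at h; lia))]
  rw [ξ, ← mul_sub, abs_mul, Nat.abs_cast, e]
  gcongr
  rw [← integral_pow_ratioLaw hν hk]
  refine (abs_integral_le_integral_abs).trans (integral_mono_of_nonneg
    (ae_of_all _ fun _ => abs_nonneg _) (integrable_pow_ratioLaw hν hk) ?_)
  filter_upwards [ae_pos_ratioLaw hν] with r hr
  refine (abs_log_one_add_sub_sum_le hr.le k).trans (div_le_self (by positivity) ?_)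
  linarith [(Nat.cast_nonneg k : (0 : ℝ) ≤ k)]

/-- For `r > 0` and `V = log (1 + r)`, the inequalities `r - r² / 2 ≤ V ≤ r` give
`0 ≤ r² - V² ≤ r³`. -/
lemma abs_integral_log_sq_sub_le {ν : ℕ} (hν : 0 < ν) (h3 : ((3 : ℕ) : ℝ) < ν / 2) :
    |∫ r, Real.log (1 + r) ^ 2 ∂ratioLaw ν - a (ν + 1) 2| ≤ a (ν + 1) 3 := by
  have h2 : ((2 : ℕ) : ℝ) < ν / 2 := lt_trans (by norm_num) h3
  rw [← integral_pow_ratioLaw hν h2, ← integral_pow_ratioLaw hν h3,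
    ← integral_sub (integrable_log_pow_ratioLaw hν 2) (integrable_pow_ratioLaw hν h2)]
  refine (abs_integral_le_integral_abs).trans (integral_mono_of_nonneg
    (ae_of_all _ fun _ => abs_nonneg _) (integrable_pow_ratioLaw hν h3) ?_)
  filter_upwards [ae_pos_ratioLaw hν] with r hr
  have h0 : 0 ≤ Real.log (1 + r) := Real.log_nonneg (by linarith)
  have h1 : Real.log (1 + r) ≤ r := by
    linarith [Real.log_le_sub_one_of_pos (show 0 < 1 + r by linarith)]
  have h4 := (abs_le.1 (abs_log_one_add_sub_sum_le hr.le 1)).1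
  norm_num at h4
  rw [abs_le]
  constructor <;> nlinarith [mul_nonneg hr.le h0, sq_nonneg r, pow_pos hr 3]

lemma integral_log_cube_le {ν : ℕ} (hν : 0 < ν) (h3 : ((3 : ℕ) : ℝ) < ν / 2) :
    ∫ r, |Real.log (1 + r) - D ν| ^ 3 ∂ratioLaw ν ≤ a (ν + 1) 3 + D ν ^ 3 := by
  have := isProbabilityMeasure_ratioLaw hν
  have hD : 0 ≤ D ν := by
    rw [← integral_log_ratioLaw hν]
    refine integral_nonneg_of_ae ?_
    filter_upwards [ae_pos_ratioLaw hν] with r hr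
    exact Real.log_nonneg (by linarith)
  have e : a (ν + 1) 3 + D ν ^ 3 = ∫ r, (r ^ 3 + D ν ^ 3) ∂ratioLaw ν := by
    rw [integral_add (integrable_pow_ratioLaw hν h3) (integrable_const _),
      integral_pow_ratioLaw hν h3]
    simp
  rw [e]
  refine integral_mono_ae (integrable_abs_log_sub_pow_ratioLaw hν _)
    ((integrable_pow_ratioLaw hν h3).add (integrable_const _)) ?_
  filter_upwards [ae_pos_ratioLaw hν] with r hr
  have h0 : 0 ≤ Real.log (1 + r) := Real.log_nonneg (by linarith)
  have h1 : Real.log (1 + r) ≤ r := by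
    linarith [Real.log_le_sub_one_of_pos (show 0 < 1 + r by linarith)]
  rcases le_total (Real.log (1 + r)) (D ν) with h | h
  · rw [abs_sub_comm, abs_of_nonneg (sub_nonneg.2 h)]
    have : (D ν - Real.log (1 + r)) ^ 3 ≤ D ν ^ 3 :=
      pow_le_pow_left₀ (sub_nonneg.2 h) (by linarith) 3
    have := pow_pos hr 3
    linarith
  · rw [abs_of_nonneg (sub_nonneg.2 h)]
    have : (Real.log (1 + r) - D ν) ^ 3 ≤ r ^ 3 :=
      pow_le_pow_left₀ (sub_nonneg.2 h) (by linarith) 3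
    have := pow_nonneg hD 3
    linarith

lemma tendsto_pow_mul_a (i : ℕ) : Tendsto (fun n : ℕ => (n : ℝ) ^ i * a n i) atTop
    (𝓝 (∏ l ∈ Finset.Icc 1 i, (2 * (l : ℝ) - 1))) := by
  have h (n : ℕ) : (n : ℝ) ^ i * a n i =
      ∏ l ∈ Finset.Icc 1 i, n * ((2 * (l : ℝ) - 1) / (dof n - 2 * l)) := by
    rw [Finset.prod_mul_distrib, Finset.prod_const, Nat.card_Icc, Nat.add_sub_cancel, a]
  simp_rw [h]
  refine tendsto_finsetProd _ fun l _ => ?_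
  have h1 : Tendsto (fun n : ℕ => (1 - (1 + 2 * (l : ℝ)) * (n : ℝ)⁻¹)) atTop (𝓝 1) := by
    simpa using (tendsto_inv_atTop_zero.comp
      (tendsto_natCast_atTop_atTop (R := ℝ))).const_mul (1 + 2 * (l : ℝ)) |>.const_sub 1
  have h2 := (tendsto_const_nhds (x := 2 * (l : ℝ) - 1)).div h1 one_ne_zero
  rw [div_one] at h2
  refine h2.congr' ?_
  filter_upwards [eventually_gt_atTop 0] with n hn
  have : (n : ℝ) ≠ 0 := by positivity
  have e : dof n - 2 * (l : ℝ) = n * (1 - (1 + 2 * (l : ℝ)) * (n : ℝ)⁻¹) := by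
    rw [dof]; field_simp; ring
  rw [Pi.div_apply, e, ← mul_div_assoc, mul_div_mul_left _ _ this]

lemma eventually_lt_half (c : ℝ) : ∀ᶠ ν : ℕ in atTop, 0 < ν ∧ c < (ν : ℝ) / 2 := by
  filter_upwards [eventually_gt_atTop 0,
    (tendsto_natCast_atTop_atTop (R := ℝ)).eventually_gt_atTop (2 * c)] with ν h1 h2
  exact ⟨h1, by linarith⟩

lemma tendsto_pow_mul_a_succ (i : ℕ) :
    Tendsto (fun ν : ℕ => ((ν + 1 : ℕ) : ℝ) ^ i * a (ν + 1) i) atTop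
      (𝓝 (∏ l ∈ Finset.Icc 1 i, (2 * (l : ℝ) - 1))) :=
  (tendsto_pow_mul_a i).comp (tendsto_add_atTop_nat 1)

lemma tendsto_inv_natCast_succ : Tendsto (fun ν : ℕ => ((ν + 1 : ℕ) : ℝ)⁻¹) atTop (𝓝 0) :=
  (tendsto_inv_atTop_zero.comp (tendsto_natCast_atTop_atTop (R := ℝ))).comp
    (tendsto_add_atTop_nat 1)

lemma tendsto_mul_D : Tendsto (fun ν : ℕ => ((ν + 1 : ℕ) : ℝ) * D ν) atTop (𝓝 1) := by
  have h1 : Tendsto (fun ν : ℕ => ((ν + 1 : ℕ) : ℝ) * D ν - ξ (ν + 1) 1) atTop (𝓝 0) := by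
    have hb := tendsto_inv_natCast_succ.mul (tendsto_pow_mul_a_succ 2)
    rw [zero_mul] at hb
    refine squeeze_zero_norm' ?_ hb
    filter_upwards [eventually_lt_half ((1 + 1 : ℕ) : ℝ)] with ν hν
    refine (abs_mul_D_sub_ξ_le hν.1 hν.2).trans_eq ?_
    have : ((ν + 1 : ℕ) : ℝ) ≠ 0 := by positivity
    field_simp
  have h2 : Tendsto (fun ν : ℕ => ξ (ν + 1) 1) atTop (𝓝 1) := by
    have := tendsto_pow_mul_a_succ 1
    norm_num at this
    simpa [ξ] using this
  simpa using h1.add h2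

lemma tendsto_sq_mul_variance : Tendsto (fun ν : ℕ => ((ν + 1 : ℕ) : ℝ) ^ 2 *
    ∫ r, (Real.log (1 + r) - D ν) ^ 2 ∂ratioLaw ν) atTop (𝓝 2) := by
  have h1 : Tendsto (fun ν : ℕ => ((ν + 1 : ℕ) : ℝ) ^ 2 *
      (∫ r, Real.log (1 + r) ^ 2 ∂ratioLaw ν - a (ν + 1) 2)) atTop (𝓝 0) := by
    have hb := tendsto_inv_natCast_succ.mul (tendsto_pow_mul_a_succ 3)
    rw [zero_mul] at hb
    refine squeeze_zero_norm' ?_ hb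
    filter_upwards [eventually_lt_half ((3 : ℕ) : ℝ)] with ν hν
    have h0 : ((ν + 1 : ℕ) : ℝ) ≠ 0 := by positivity
    rw [norm_mul, norm_pow, Real.norm_natCast]
    calc _ ≤ ((ν + 1 : ℕ) : ℝ) ^ 2 * a (ν + 1) 3 := by
          gcongr
          exact abs_integral_log_sq_sub_le hν.1 hν.2
      _ = _ := by field_simp
  have h2 := tendsto_pow_mul_a_succ 2
  have e2 : ∏ l ∈ Finset.Icc (1 : ℕ) 2, (2 * (l : ℝ) - 1) = 3 := by
    norm_num [Finset.prod_Icc_succ_top]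
  rw [e2] at h2
  have h3 := (h1.add h2).sub (tendsto_mul_D.pow 2)
  norm_num at h3
  refine h3.congr' ?_
  filter_upwards [eventually_gt_atTop 0] with ν hν
  have := isProbabilityMeasure_ratioLaw hν
  have hlog : Integrable (fun r => Real.log (1 + r)) (ratioLaw ν) := by
    simpa using integrable_log_pow_ratioLaw hν 1
  have e : ∫ r, (Real.log (1 + r) - D ν) ^ 2 ∂ratioLaw ν =
      ∫ r, Real.log (1 + r) ^ 2 ∂ratioLaw ν - D ν ^ 2 := by
    have e1 (r : ℝ) : (Real.log (1 + r) - D ν) ^ 2 =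
        Real.log (1 + r) ^ 2 - (2 * D ν * Real.log (1 + r) - D ν ^ 2) := by ring
    simp_rw [e1]
    have h5 : Integrable (fun r => 2 * D ν * Real.log (1 + r) - D ν ^ 2) (ratioLaw ν) :=
      (hlog.const_mul _).sub (integrable_const _)
    rw [integral_sub (integrable_log_pow_ratioLaw hν 2) h5,
      integral_sub (hlog.const_mul _) (integrable_const _), integral_const_mul,
      integral_log_ratioLaw hν]
    simp
    ring
  rw [e]
  push_cast
  ring

/-- The bound is any number above `15 + 1`, the limit of `n³ a₃ + (n D ν)³`. -/
lemma eventually_cube_mul_integral_le : ∀ᶠ ν : ℕ in atTop, ((ν + 1 : ℕ) : ℝ) ^ 3 *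
    ∫ r, |Real.log (1 + r) - D ν| ^ 3 ∂ratioLaw ν ≤ 17 := by
  have h := (tendsto_pow_mul_a_succ 3).add (tendsto_mul_D.pow 3)
  have e : ∏ l ∈ Finset.Icc (1 : ℕ) 3, (2 * (l : ℝ) - 1) = 15 := by
    norm_num [Finset.prod_Icc_succ_top]
  rw [e] at h
  norm_num at h
  filter_upwards [eventually_lt_half ((3 : ℕ) : ℝ),
    h.eventually (Iic_mem_nhds (show (16 : ℝ) < 17 by norm_num))] with ν hν hle
  calc _ ≤ ((ν + 1 : ℕ) : ℝ) ^ 3 * (a (ν + 1) 3 + D ν ^ 3) := by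
        gcongr
        exact integral_log_cube_le hν.1 hν.2
    _ ≤ 17 := by
        push_cast
        have : ((ν : ℝ) + 1) ^ 3 * a (ν + 1) 3 + (((ν : ℝ) + 1) * D ν) ^ 3 ≤ 17 := hle
        linarith [mul_pow ((ν : ℝ) + 1) (D ν) 3]

/-! ### The limit theorem for the test statistic -/

/-- The central limit theorem for `∑ⱼ log (1 + tⱼ² / ν)`, centered at its mean `p D(ν)`, scaled by
`cₘ / √p`, and shifted by a null sequence. -/
theorem tendstoInDistribution_sum_log {Ω : ℕ → Type*} [∀ m, MeasurableSpace (Ω m)]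
    {P : ∀ m, Measure (Ω m)} [∀ m, IsProbabilityMeasure (P m)] {ν p : ℕ → ℕ}
    {μ : ∀ m, EuclideanSpace ℝ (Fin (p m))} {S : ∀ m, Matrix (Fin (p m)) (Fin (p m)) ℝ}
    {X : ∀ m, Fin (ν m + 1) → Ω m → EuclideanSpace ℝ (Fin (p m))}
    (hν : ∀ m, 0 < ν m) (hX : ∀ m, IsNormalSample (P m) (X m) (μ m) (S m))
    (hS : ∀ m, (S m).PosDef) (hdiag : ∀ m, (S m).IsDiag) (hp : Tendsto p atTop atTop)
    {c : ℕ → ℝ} (hc : ∀ m, 0 ≤ c m)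
    (h2 : Tendsto (fun m => c m ^ 2 * ∫ r, (Real.log (1 + r) - D (ν m)) ^ 2 ∂ratioLaw (ν m))
      atTop (𝓝 1))
    {C : ℝ} (h3 : ∀ᶠ m in atTop,
      c m ^ 3 * ∫ r, |Real.log (1 + r) - D (ν m)| ^ 3 ∂ratioLaw (ν m) ≤ C)
    {e : ℕ → ℝ} (he : Tendsto e atTop (𝓝 0)) :
    TendstoInDistribution (fun m ω => (√(p m))⁻¹ * (c m *
        (∑ j, Real.log (1 + tStat (μ m) (fun i => X m i ω) j ^ 2 / dof (ν m + 1)) -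
          p m * D (ν m))) + e m)
      atTop (id : ℝ → ℝ) P (gaussianReal 0 1) := by
  have := fun m => isProbabilityMeasure_ratioLaw (hν m)
  set g : ℕ → ℝ → ℝ := fun m r => c m * (Real.log (1 + r) - D (ν m)) with hg
  have hgm (m : ℕ) : Measurable (g m) := by fun_prop
  have := fun m => Measure.isProbabilityMeasure_map (μ := ratioLaw (ν m)) (hgm m).aemeasurable
  have hlaw (m : ℕ) (j : Fin (p m)) : HasLaw
      (fun ω => g m (tStat (μ m) (fun i => X m i ω) j ^ 2 / dof (ν m + 1)))
      ((ratioLaw (ν m)).map (g m)) (P m) :=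
    (HasLaw.mk (hgm m).aemeasurable rfl : HasLaw (g m) _ (ratioLaw (ν m))).comp
      ((hX m).hasLaw_tStat_sq (hν m) (hS m) j)
  have hind (m : ℕ) := ((hX m).iIndepFun_tStat_sq (hν m) (hS m).posSemidef (hdiag m)).comp
    (fun _ => g m) fun _ => hgm m
  have habs (m : ℕ) (r : ℝ) : |g m r| ^ 3 = c m ^ 3 * |Real.log (1 + r) - D (ν m)| ^ 3 := by
    rw [hg, abs_mul, mul_pow, abs_of_nonneg (hc m)]
  have hlog (m : ℕ) : Integrable (fun r => Real.log (1 + r)) (ratioLaw (ν m)) := by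
    simpa using integrable_log_pow_ratioLaw (hν m) 1
  have key := tendstoInDistribution_sum_div_sqrt_add (lam := fun m => (ratioLaw (ν m)).map (g m))
    (C := C) hlaw hind hp
    (Eventually.of_forall fun m => by
      rw [integrable_map_measure (by fun_prop) (hgm m).aemeasurable]
      simp_rw [Function.comp_def, habs]
      exact (integrable_abs_log_sub_pow_ratioLaw (hν m) _).const_mul _)
    (Eventually.of_forall fun m => by
      rw [integral_map (hgm m).aemeasurable (by fun_prop)]
      simp only [hg]
      rw [integral_const_mul, integral_sub (hlog m) (integrable_const _),
        integral_log_ratioLaw (hν m)]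
      simp)
    (h2.congr fun m => by
      rw [integral_map (hgm m).aemeasurable (by fun_prop)]
      simp only [hg, mul_pow]
      rw [integral_const_mul])
    (h3.mono fun m hm => by
      rw [integral_map (hgm m).aemeasurable (by fun_prop)]
      simp only [habs]
      rwa [integral_const_mul]) he
  convert! key using 5 with m ω
  simp only [hg]
  rw [← Finset.mul_sum, Finset.sum_sub_distrib]
  simp

/-- For samples of size `ν + 1` with `p = o(ν ^ (2k))`, the mean of `T₁` may be replaced by
`p ξ_k`. -/
lemma tendsto_sqrt_mul_D_sub_ξ {ν p : ℕ → ℕ} {k : ℕ} (hν : Tendsto ν atTop atTop)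
    (hp : (fun m => (p m : ℝ)) =o[atTop] fun m => ((ν m + 1 : ℕ) : ℝ) ^ (2 * k)) :
    Tendsto (fun m => √(p m) * (((ν m + 1 : ℕ) : ℝ) * D (ν m) - ξ (ν m + 1) k) / √2) atTop
      (𝓝 0) := by
  have h1 : Tendsto (fun m => √((p m : ℝ) / ((ν m + 1 : ℕ) : ℝ) ^ (2 * k))) atTop (𝓝 0) := by
    rw [← Real.sqrt_zero]
    exact (Real.continuous_sqrt.tendsto 0).comp hp.tendsto_div_nhds_zero
  have h2 := h1.mul ((tendsto_pow_mul_a_succ (k + 1)).comp hν)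
  rw [zero_mul] at h2
  rw [← zero_div (√2)]
  refine Tendsto.div_const (squeeze_zero_norm' ?_ h2) _
  filter_upwards [hν.eventually (eventually_lt_half ((k + 1 : ℕ) : ℝ))] with m hm
  have h0 : (0 : ℝ) < ((ν m + 1 : ℕ) : ℝ) := by positivity
  rw [norm_mul, Real.norm_of_nonneg (Real.sqrt_nonneg _), Real.sqrt_div (Nat.cast_nonneg _),
    mul_comm 2 k, pow_mul, Real.sqrt_sq (by positivity)]
  calc _ ≤ √(p m) * (((ν m + 1 : ℕ) : ℝ) * a (ν m + 1) (k + 1)) := by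
        gcongr
        exact abs_mul_D_sub_ξ_le hm.1 hm.2
    _ = _ := by
        simp only [Function.comp_apply]
        field_simp
        ring

end DLRT

theorem corollary1
    {Ω : ℕ → Type*} [∀ m, MeasurableSpace (Ω m)]
    (P : ∀ m, Measure (Ω m)) [∀ m, IsProbabilityMeasure (P m)]
    (n p : ℕ → ℕ)
    (μ μ₀ : ∀ m, EuclideanSpace ℝ (Fin (p m)))
    (S : ∀ m, Matrix (Fin (p m)) (Fin (p m)) ℝ)
    (X : ∀ m, Fin (n m) → Ω m → EuclideanSpace ℝ (Fin (p m)))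
    (hX : ∀ m, DLRT.IsNormalSample (P m) (X m) (μ m) (S m))
    (hS : ∀ m, (S m).PosDef) (hdiag : ∀ m, (S m).IsDiag)
    (hH₀ : ∀ m, μ m = μ₀ m)
    (hp : Tendsto p atTop atTop) :
    (∀ N : ℕ, 2 ≤ N → (∀ m, n m = N) →
      TendstoInDistribution
        (fun m ω => (DLRT.T₁ (μ₀ m) (fun i => X m i ω) - p m * DLRT.m₁ N) /
          √((p m : ℝ) * (DLRT.m₂ N - DLRT.m₁ N ^ 2)))
        atTop (id : ℝ → ℝ) P (gaussianReal 0 1)) ∧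
    (∀ k : ℕ, 1 ≤ k → (∀ m, (k : ℝ) < DLRT.dof (n m) / 2) →
      Tendsto n atTop atTop →
      (fun m => (p m : ℝ)) =o[atTop] (fun m => (n m : ℝ) ^ (2 * k)) →
      TendstoInDistribution
        (fun m ω => (DLRT.T₁ (μ₀ m) (fun i => X m i ω) - p m * DLRT.ξ (n m) k) /
          √(2 * (p m : ℝ)))
        atTop (id : ℝ → ℝ) P (gaussianReal 0 1)) := by
  obtain rfl : μ = μ₀ := funext hH₀
  constructor
  · intro N hN hn
    obtain ⟨ν, rfl⟩ : ∃ ν, N = ν + 1 := ⟨N - 1, by lia⟩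
    obtain rfl : n = fun _ => ν + 1 := funext hn
    have hν : 0 < ν := by lia
    have hvar := DLRT.integral_sq_log_sub_ratioLaw hν
    have hpos := DLRT.integral_sq_log_sub_ratioLaw_pos hν
    set v := ∫ r, (Real.log (1 + r) - DLRT.D ν) ^ 2 ∂DLRT.ratioLaw ν with hv
    have hs : 0 < √v := Real.sqrt_pos.2 hpos
    have key := DLRT.tendstoInDistribution_sum_log (ν := fun _ => ν) (c := fun _ => (√v)⁻¹)
      (fun _ => hν) hX hS hdiag hp (fun _ => by positivity)
      (by
        rw [inv_pow, Real.sq_sqrt hpos.le, ← hv, inv_mul_cancel₀ hpos.ne']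
        exact tendsto_const_nhds)
      (Eventually.of_forall fun _ => le_rfl) (e := 0) tendsto_const_nhds
    convert! key using 3 with m ω
    have e1 : DLRT.m₂ (ν + 1) - DLRT.m₁ (ν + 1) ^ 2 = ((ν + 1 : ℕ) : ℝ) ^ 2 * v := by
      rw [hvar, DLRT.m₂, DLRT.m₁, DLRT.dof_succ]
      ring
    have h0 : (0 : ℝ) < ((ν + 1 : ℕ) : ℝ) := by positivity
    rw [e1, Real.sqrt_mul (Nat.cast_nonneg _), Real.sqrt_mul (by positivity),
      Real.sqrt_sq h0.le, DLRT.T₁, DLRT.m₁, DLRT.dof_succ]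
    simp only [Pi.zero_apply, add_zero]
    field_simp
  · intro k hk hkn hn hpo
    have hn1 (m : ℕ) : 2 < n m := by
      have h1 : (1 : ℝ) ≤ k := by exact_mod_cast hk
      have h2 := hkn m
      rw [DLRT.dof] at h2
      have h3 : (2 : ℝ) < n m := by linarith
      exact_mod_cast h3
    obtain ⟨ν, rfl⟩ : ∃ ν : ℕ → ℕ, n = fun m => ν m + 1 :=
      ⟨fun m => n m - 1, funext fun m => by have := hn1 m; lia⟩
    have hν (m : ℕ) : 0 < ν m := by have := hn1 m; lia
    have hνt : Tendsto ν atTop atTop := (tendsto_sub_atTop_nat 1).comp hn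
    have h2s : √(2 : ℝ) ^ 2 = 2 := Real.sq_sqrt (by norm_num)
    have h20 : 0 < √(2 : ℝ) := by positivity
    have h21 : 1 ≤ √(2 : ℝ) := Real.one_le_sqrt.2 (by norm_num)
    have key := DLRT.tendstoInDistribution_sum_log (C := 17)
      (c := fun m => ((ν m + 1 : ℕ) : ℝ) / √2) hν hX hS hdiag hp (fun _ => by positivity)
      (by
        have := (DLRT.tendsto_sq_mul_variance.comp hνt).div_const 2
        rw [div_self two_ne_zero] at this
        refine this.congr fun m => ?_
        rw [div_pow, h2s, Function.comp_apply]
        ring)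
      (by
        filter_upwards [hνt.eventually DLRT.eventually_cube_mul_integral_le] with m hm
        refine le_trans ?_ hm
        gcongr
        exact div_le_self (by positivity) h21)
      (DLRT.tendsto_sqrt_mul_D_sub_ξ hνt hpo)
    convert! key using 3 with m ω
    rw [Real.sqrt_mul (by norm_num), DLRT.T₁]
    -- If `p m = 0`, both sides are `0` by the convention for division by zero.
    rcases (Real.sqrt_nonneg (p m : ℝ)).eq_or_lt with h | h
    · rw [← h]
      simp
    · have hpm : (p m : ℝ) = √(p m : ℝ) ^ 2 := (Real.sq_sqrt (Nat.cast_nonneg _)).symm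
      set s := √(p m : ℝ)
      rw [hpm]
      field_simp
      ring
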